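/- Let $N\ge 0$ be an integer, let $q\in\mathbb{C}\setminus\{0,-1\}$, and let $x_1,\dots,x_N\in\mathbb{C}$ satisfy $x_i\ne x_j$ and $x_i\neq qx_j$ for all $i\ne j$. Write $E_{ab}$ ($a,b\in\{0,1,2\}$) for the elementary $3\times3$ matrices, with rows and columns numbered $0,1,2$. A subscript $i$ on a $3\times 3$ matrix means that it acts on the $i$-th factor $V_i$ of $V_1\otimes\cdots\otimes V_N$, $V_i=\mathbb{C}^3$. Define the diagonal matrices $$d_i(z)=\mathrm{diag}\Big(1,\tfrac{x_i-z}{x_i-q^2z},\tfrac{(x_i-z)(x_i-qz)}{(x_i-q^2z)(x_i-q^3z)}\Big)_i,\qquad d_i^{\circ}(z)=\mathrm{diag}\Big(1,\tfrac{(qx_i-z)(x_i-q^2z)}{(1+q)(x_i-z)},\tfrac{x_i-q^3z}{x_i-qz}\Big)_i,$$ $$d_i^{\bullet}(z)=\mathrm{diag}\Big(1,\tfrac{1+q}{qx_i-z},\tfrac{x_i-q^2z}{x_i-z}\Big)_i,\qquad d_i^{\bullet\circ}(z)=\mathrm{diag}\Big(1,\tfrac{x_i-q^2z}{x_i-z},\tfrac{(x_i-q^2z)(x_i-q^3z)}{(x_i-z)(x_i-qz)}\Big)_i,$$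 the off-diagonal matrices $$e_i^{\circ}(z)=\tfrac{(1-q^2)z}{x_i-q^2z}(E_{10})_i,\qquad e_i^{\bullet}(z)=\tfrac{q(1-q)^2(1+q)(x_i-z)z}{(x_i-q^2z)(x_i-q^3z)}(E_{21})_i,\qquad e_i^{\bullet\circ}(z)=\tfrac{(1-q^2)(x_i+q^2x_i-q^2z-q^3z)z}{(x_i-q^2z)(x_i-q^3z)}(E_{20})_i,$$ and, for $i\ne j$, $$e_{ij}^{\circ\circ}(z)=\tfrac{x_ix_j+q^2x_ix_j-q^2x_iz-q^2x_jz}{(1-q^2)z}\,e_i^\circ(z)e_j^\circ(z),\qquad e_{ij}^{\bullet\circ}(z)=e_{ji}^{\circ\bullet}(z)=\tfrac{x_ix_j+q^2x_ix_j-q^2x_iz-q^3x_jz}{q(1-q)(x_i-x_j)z}\,e_i^\bullet(z)e_j^\circ(z),$$ $$e_{ij}^{\bullet\bullet}(z)=\tfrac{(1+q)(x_ix_j+q^2x_ix_j-q^3x_iz-q^3x_jz)}{q(1-q)(x_i-qx_j)(x_j-qx_i)z}\,e_i^\bullet(z)e_j^\bullet(z),$$ where the factors $z$ and $1-q$ in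 the last three denominators are cancelled against the numerators (so that these matrices vanish for $z=0$ and for $q=1$). The twisted column operators on $V_1\otimes\cdots\otimes V_N$ are $$\Gamma_0(z)=\prod_{i=1}^N d_i(z),\qquad \Gamma_1(z)=\sum_{u\in\{\circ,\bullet\}}\sum_{i=1}^N e_i^u(z)\prod_{j\ne i}d_j(z)d_j^u(x_i),$$ $$\Gamma_2(z)=\sum_{i=1}^N e_i^{\bullet\circ}(z)\prod_{j\neq i}d_j(z)d_j^{\bullet\circ}(x_i)+\sum_{u,v\in\{\circ,\bullet\}}\ \sum_{1\le i<j\le N}e_{ij}^{uv}(z)\prod_{k\ne i,j}d_k(z)d_k^u(x_i)d_k^v(x_j).$$ Write $\Gamma_k(z)=\Gamma_k(z;x_1,\dots,x_N)$ and let $\langle a_1,\dots,a_N|\Gamma_k|b_1,\dots,b_N\rangle$, with $a_i,b_i\in\{0,1,2\}$, denote its matrix entries (row $a$, column $b$) in the standard basis. The Izergin--Korepin vertex weights $W_{y/x}(i,j;k,\ell)$, $i,j,k,\ell\in\{0,1,2\}$, are the following functions of the ratio $y/x$, where $A=x-q^2y$ and $D=(x-q^2y)(x-q^3y)$; all weights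 not listed are zero: $$W(0,0;0,0)=W(2,2;2,2)=1,$$ $$W(1,0;1,0)=W(2,1;2,1)=\tfrac{q^2(x-y)}{A},\quad W(1,0;0,1)=W(2,1;1,2)=\tfrac{(1-q^2)x}{A},$$ $$W(0,1;1,0)=W(1,2;2,1)=\tfrac{(1-q^2)y}{A},\quad W(0,1;0,1)=W(1,2;1,2)=\tfrac{x-y}{A},$$ $$W(2,0;2,0)=\tfrac{q^4(x-y)(x-qy)}{D},\quad W(2,0;1,1)=-\tfrac{q(1-q)^2(1+q)x(x-y)}{D},\quad W(2,0;0,2)=\tfrac{(1-q^2)x(x+qx-qy-q^3y)}{D},$$ $$W(1,1;2,0)=-\tfrac{q^4(1+q)(x-y)y}{D},\quad W(1,1;1,1)=\tfrac{-qx^2+(1+q)(1-q^2+q^4)xy-q^4y^2}{D},\quad W(1,1;0,2)=\tfrac{(1+q)x(x-y)}{D},$$ $$W(0,2;2,0)=\tfrac{(1-q^2)(x+q^2x-q^2y-q^3y)y}{D},\quad W(0,2;1,1)=\tfrac{q(1-q)^2(1+q)(x-y)y}{D},\quad W(0,2;0,2)=\tfrac{(x-y)(x-qy)}{D}.$$ (For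 $x=0$, $y\neq 0$, where the ratio is infinite, $W_{y/x}$ is understood through these formulas.) Then the following hold. (1) For every $k\in\{0,1,2\}$, every $z\in\mathbb{C}$ with $x_i\notin\{q^2z,q^3z\}$ for all $i$, every permutation $\sigma\in\mathfrak{S}_N$ and all $a_i,b_i\in\{0,1,2\}$, $$\langle a_{\sigma(1)},\dots,a_{\sigma(N)}|\,\Gamma_k(z;x_{\sigma(1)},\dots,x_{\sigma(N)})\,|b_{\sigma(1)},\dots,b_{\sigma(N)}\rangle=\langle a_1,\dots,a_N|\,\Gamma_k(z;x_1,\dots,x_N)\,|b_1,\dots,b_N\rangle.$$ (2) For all $k,\ell\in\{0,1,2\}$ and all $z,y\in\mathbb{C}$ with $x_i\notin\{q^2z,q^3z,q^2y,q^3y\}$ for all $i$ and $y\notin\{q^2z,q^3z\}$, $$\Gamma_k(z)\Gamma_\ell(y)=\sum_{i=0}^2\sum_{j=0}^2W_{z/y}(i,j;k,\ell)\,\Gamma_j(y)\Gamma_i(z).$$ -/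

import Mathlib

namespace IzerginKorepin

/-- The two elementary labels `∘` and `•`. -/
inductive Dot : Type
  | circ : Dot
  | bull : Dot
  deriving DecidableEq

instance : Fintype Dot where
  elems := {Dot.circ, Dot.bull}
  complete := by intro u; cases u <;> decide

/-- The vertex weight `W_{y/x}(i,j;k,l)` of the Izergin-Korepin nineteen-vertex model, with
`x` (resp. `y`) the spectral parameter of the horizontal (resp. vertical) line. The edge states are
read clockwise: `i` bottom, `j` left, `k` top, `l` right. Every weight is homogeneous of
degree zero in `(x, y)`. -/
noncomputable def W (q x y : ℂ) : Fin 3 → Fin 3 → Fin 3 → Fin 3 → ℂ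
  | 0, 0, 0, 0 => 1
  | 1, 0, 1, 0 => q ^ 2 * (x - y) / (x - q ^ 2 * y)
  | 1, 0, 0, 1 => (1 - q ^ 2) * x / (x - q ^ 2 * y)
  | 2, 0, 2, 0 => q ^ 4 * (x - y) * (x - q * y) / ((x - q ^ 2 * y) * (x - q ^ 3 * y))
  | 2, 0, 1, 1 =>
      -(q * (1 - q) ^ 2 * (1 + q) * x * (x - y) / ((x - q ^ 2 * y) * (x - q ^ 3 * y)))
  | 2, 0, 0, 2 =>
      (1 - q ^ 2) * x * (x + q * x - q * y - q ^ 3 * y) / ((x - q ^ 2 * y) * (x - q ^ 3 * y))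
  | 0, 1, 1, 0 => (1 - q ^ 2) * y / (x - q ^ 2 * y)
  | 0, 1, 0, 1 => (x - y) / (x - q ^ 2 * y)
  | 1, 1, 2, 0 => -(q ^ 4 * (1 + q) * (x - y) * y / ((x - q ^ 2 * y) * (x - q ^ 3 * y)))
  | 1, 1, 1, 1 =>
      (-(q * x ^ 2) + (1 + q) * (1 - q ^ 2 + q ^ 4) * x * y - q ^ 4 * y ^ 2) /
        ((x - q ^ 2 * y) * (x - q ^ 3 * y))
  | 1, 1, 0, 2 => (1 + q) * x * (x - y) / ((x - q ^ 2 * y) * (x - q ^ 3 * y))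
  | 2, 1, 2, 1 => q ^ 2 * (x - y) / (x - q ^ 2 * y)
  | 2, 1, 1, 2 => (1 - q ^ 2) * x / (x - q ^ 2 * y)
  | 0, 2, 2, 0 =>
      (1 - q ^ 2) * (x + q ^ 2 * x - q ^ 2 * y - q ^ 3 * y) * y /
        ((x - q ^ 2 * y) * (x - q ^ 3 * y))
  | 0, 2, 1, 1 =>
      q * (1 - q) ^ 2 * (1 + q) * (x - y) * y / ((x - q ^ 2 * y) * (x - q ^ 3 * y))
  | 0, 2, 0, 2 => (x - y) * (x - q * y) / ((x - q ^ 2 * y) * (x - q ^ 3 * y))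
  | 1, 2, 2, 1 => (1 - q ^ 2) * y / (x - q ^ 2 * y)
  | 1, 2, 1, 2 => (x - y) / (x - q ^ 2 * y)
  | 2, 2, 2, 2 => 1
  | _, _, _, _ => 0

/-- The diagonal matrix `d(z)` on a site with spectral parameter `x`. -/
noncomputable def d (q x z : ℂ) : Matrix (Fin 3) (Fin 3) ℂ :=
  Matrix.diagonal
    ![1, (x - z) / (x - q ^ 2 * z),
      (x - z) * (x - q * z) / ((x - q ^ 2 * z) * (x - q ^ 3 * z))]

/-- The diagonal matrices `d^∘(z)` and `d^•(z)` on a site with spectral parameter `x`. -/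
noncomputable def dDot (q : ℂ) : Dot → ℂ → ℂ → Matrix (Fin 3) (Fin 3) ℂ
  | .circ, x, z =>
      Matrix.diagonal
        ![1, (q * x - z) * (x - q ^ 2 * z) / ((1 + q) * (x - z)),
          (x - q ^ 3 * z) / (x - q * z)]
  | .bull, x, z =>
      Matrix.diagonal ![1, (1 + q) / (q * x - z), (x - q ^ 2 * z) / (x - z)]

/-- The diagonal matrix `d^{•∘}(z)` on a site with spectral parameter `x`. -/
noncomputable def dBoth (q x z : ℂ) : Matrix (Fin 3) (Fin 3) ℂ :=
  Matrix.diagonal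
    ![1, (x - q ^ 2 * z) / (x - z),
      (x - q ^ 2 * z) * (x - q ^ 3 * z) / ((x - z) * (x - q * z))]

/-- The off-diagonal matrices `e^∘(z)` and `e^•(z)` on a site with spectral parameter `x`. -/
noncomputable def eDot (q : ℂ) : Dot → ℂ → ℂ → Matrix (Fin 3) (Fin 3) ℂ
  | .circ, x, z => ((1 - q ^ 2) * z / (x - q ^ 2 * z)) • !![0, 0, 0; 1, 0, 0; 0, 0, 0]
  | .bull, x, z =>
      (q * (1 - q) ^ 2 * (1 + q) * (x - z) * z / ((x - q ^ 2 * z) * (x - q ^ 3 * z))) •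
        !![0, 0, 0; 0, 0, 0; 0, 1, 0]

/-- The off-diagonal matrix `e^{•∘}(z)` on a site with spectral parameter `x`. -/
noncomputable def eBoth (q x z : ℂ) : Matrix (Fin 3) (Fin 3) ℂ :=
  ((1 - q ^ 2) * (x + q ^ 2 * x - q ^ 2 * z - q ^ 3 * z) * z /
      ((x - q ^ 2 * z) * (x - q ^ 3 * z))) •
    !![0, 0, 0; 0, 0, 0; 1, 0, 0]

/-- The scalar relating `e_{ij}^{•∘}(z)` to `e_i^•(z) e_j^∘(z)`, for two sites with spectral
parameters `x₁` (site `i`) and `x₂` (site `j`). -/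
noncomputable def bullCircCoeff (q x₁ x₂ z : ℂ) : ℂ :=
  (x₁ * x₂ + q ^ 2 * x₁ * x₂ - q ^ 2 * x₁ * z - q ^ 3 * x₂ * z) /
    (q * (1 - q) * (x₁ - x₂) * z)

/-- The scalar `c` with `e_{ij}^{uv}(z) = c * e_i^u(z) e_j^v(z)`, for two sites with spectral
parameters `x₁` (site `i`) and `x₂` (site `j`). The case `∘•` expresses
`e_{ij}^{∘•} = e_{ji}^{•∘}`. The factors `z` and `1 - q` in the denominators are removable in
`e_{ij}^{uv}(z)`, which tends to zero as `z → 0` or `q → 1`; this is also the value that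
division by zero gives there. -/
noncomputable def pairCoeff (q : ℂ) : Dot → Dot → ℂ → ℂ → ℂ → ℂ
  | .circ, .circ, x₁, x₂, z =>
      (x₁ * x₂ + q ^ 2 * x₁ * x₂ - q ^ 2 * x₁ * z - q ^ 2 * x₂ * z) / ((1 - q ^ 2) * z)
  | .bull, .circ, x₁, x₂, z => bullCircCoeff q x₁ x₂ z
  | .circ, .bull, x₁, x₂, z => bullCircCoeff q x₂ x₁ z
  | .bull, .bull, x₁, x₂, z =>
      (1 + q) * (x₁ * x₂ + q ^ 2 * x₁ * x₂ - q ^ 3 * x₁ * z - q ^ 3 * x₂ * z) /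
        (q * (1 - q) * (x₁ - q * x₂) * (x₂ - q * x₁) * z)

/-- The matrix of `M₁ ⊗ ⋯ ⊗ M_N` acting on `(ℂ³)^{⊗N}`, in the basis of pure tensors of standard
basis vectors, which is indexed by `Fin N → Fin 3`. -/
def tensor {N : ℕ} (M : Fin N → Matrix (Fin 3) (Fin 3) ℂ) :
    Matrix (Fin N → Fin 3) (Fin N → Fin 3) ℂ :=
  Matrix.of fun a b => ∏ i, M i (a i) (b i)

/-- The twisted column operators `Γ_k(z) = Γ_k(z; x₁, …, x_N)`, `k = 0, 1, 2`. -/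
noncomputable def Gamma {N : ℕ} (q : ℂ) (x : Fin N → ℂ) :
    Fin 3 → ℂ → Matrix (Fin N → Fin 3) (Fin N → Fin 3) ℂ
  | 0, z => tensor fun i => d q (x i) z
  | 1, z =>
      ∑ u : Dot, ∑ i : Fin N,
        tensor fun j =>
          if j = i then eDot q u (x i) z
          else d q (x j) z * dDot q u (x j) (x i)
  | 2, z =>
      (∑ i : Fin N,
        tensor fun j =>
          if j = i then eBoth q (x i) z
          else d q (x j) z * dBoth q (x j) (x i)) +
      ∑ u : Dot, ∑ v : Dot, ∑ i : Fin N, ∑ j ∈ Finset.Ioi i,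
        pairCoeff q u v (x i) (x j) z •
          tensor fun k =>
            if k = i then eDot q u (x i) z
            else if k = j then eDot q v (x j) z
            else d q (x k) z * dDot q u (x k) (x i) * dDot q v (x k) (x j)

end IzerginKorepin

/-! Entry `(a, c)` of a column operator is a sum over the ways of lowering sites from `a` to `c`;
every idle site contributes its diagonal weight times one dressing factor for each moved site. This
form does not depend on the order of the sites, which is part (1) (`Gamma_comp_perm`).

For part (2), two facts reduce any bilinear relation to few sites. The dressing factors form a
cocycle, d^• d^∘ = d^{•∘}, so in a product of two operators the idle sites contribute a factor that
depends neither on the intermediate state nor on the order of the operators (`colOp_mul_restrict`).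
The operator with index `k` lowers the total state by `k`, so at most `k + l` sites are active.
Hence a relation in which `k + l` is conserved need only be checked when all of at most `k + l`
sites move, with sorted states (`exchange_of_active`).

Checking all nine exchange relations in this way would involve four sites and two spectral
parameters. Instead let `F` and `K` be the limits of Γ_1(z) and Γ_0(z) as z → ∞. The limiting
exchange relations express `F * Γ_k(y)` through `Γ_k(y) * F` and `Γ_{k+1}(y) * K`
(`isRaising_gammaData`); they involve one parameter and at most three sites. Multiplying an exchange
relation on the left by `F` and subtracting a multiple of its product with `F` on the right gives
relations of total degree one higher, since `K` is invertible. The relations (1,0), (0,1) and (0,2),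
computed directly, thus yield (1,1), (2,0), (2,1), (1,2) and (2,2); (0,0) says that diagonal
matrices commute. The method divides by factors that vanish at q = 1, where Γ_1 = Γ_2 = 0 and the
relations are immediate. -/

namespace IzerginKorepin

open Finset Function

variable {N n : ℕ}

/-! ### Column operators with general local weights -/

/-- The local weights of a column operator, as functions of the final state of a site and of its
spectral parameter: the diagonal entries, the weights for lowering one site by one, one site from
`2` to `0`, and two distinct sites by one each. -/
structure ColumnData where
  diag : Fin 3 → ℂ → ℂ
  single : Fin 3 → ℂ → ℂ
  double : ℂ → ℂ
  pair : Fin 3 → Fin 3 → ℂ → ℂ → ℂ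
  single_zero : ∀ x, single 0 x = 0
  pair_zero_left : ∀ s x y, pair 0 s x y = 0
  pair_zero_right : ∀ s x y, pair s 0 x y = 0
  pair_symm : ∀ s t x y, pair s t x y = pair t s y x

/-- The diagonal entries of `d^∘` (for `s = 1`) and `d^•` (for `s = 2`). -/
noncomputable def dress (q : ℂ) : Fin 3 → ℂ → ℂ → Fin 3 → ℂ
  | 0, _, _ => 1
  | 1, x, z =>
    ![1, (q * x - z) * (x - q ^ 2 * z) / ((1 + q) * (x - z)), (x - q ^ 3 * z) / (x - q * z)]
  | 2, x, z => ![1, (1 + q) / (q * x - z), (x - q ^ 2 * z) / (x - z)]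

/-- The diagonal entries of `d^{•∘}`. -/
noncomputable def dressBoth (q x z : ℂ) : Fin 3 → ℂ :=
  ![1, (x - q ^ 2 * z) / (x - z),
    (x - q ^ 2 * z) * (x - q ^ 3 * z) / ((x - z) * (x - q * z))]

/-- The factor contributed by an idle site in state `r` when another site goes from `t` to `s`. -/
noncomputable def dressJump (q : ℂ) (s t : Fin 3) (x z : ℂ) (r : Fin 3) : ℂ :=
  if t = s then 1 else if t = s - 1 then dress q s x z r else dressBoth q x z r

/-- The column operators attached to local weights. -/
noncomputable def colOp (L : ColumnData) (q : ℂ) (x : Fin N → ℂ) :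
    Fin 3 → Matrix (Fin N → Fin 3) (Fin N → Fin 3) ℂ
  | 0 => Matrix.of fun a c => if c = a then ∏ j, L.diag (a j) (x j) else 0
  | 1 => Matrix.of fun a c => ∑ i, if c = update a i (a i - 1) then
      L.single (a i) (x i) * ∏ j ∈ {i}ᶜ, L.diag (a j) (x j) * dress q (a i) (x j) (x i) (a j)
      else 0
  | 2 => Matrix.of fun a c =>
      (∑ i, if a i = 2 ∧ c = update a i 0 then
        L.double (x i) * ∏ j ∈ {i}ᶜ, L.diag (a j) (x j) * dressBoth q (x j) (x i) (a j)
        else 0) +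
      2⁻¹ * ∑ i, ∑ j, if i ≠ j ∧ c = update (update a i (a i - 1)) j (a j - 1) then
        L.pair (a i) (a j) (x i) (x j) * ∏ k ∈ {i, j}ᶜ, L.diag (a k) (x k) *
          (dress q (a i) (x k) (x i) (a k) * dress q (a j) (x k) (x j) (a k))
        else 0

/-! ### Idle sites and the reduction to few active sites -/

/-- The factor contributed to a matrix entry by the sites outside the range of `g`. -/
noncomputable def outer (L : ColumnData) (q : ℂ) (x : Fin N → ℂ) (g : Fin n ↪ Fin N)
    (a c : Fin N → Fin 3) : ℂ :=
  ∏ j ∈ (univ.map g)ᶜ, L.diag (a j) (x j) *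
    ∏ i, dressJump q (a (g i)) (c (g i)) (x j) (x (g i)) (a j)

theorem prod_compl_map (g : Fin n ↪ Fin N) (T : Finset (Fin n)) (f : Fin N → ℂ) :
    ∏ j ∈ (T.map g)ᶜ, f j = (∏ j ∈ (univ.map g)ᶜ, f j) * ∏ j ∈ Tᶜ, f (g j) := by
  rw [← Finset.prod_map Tᶜ g f, ← Finset.prod_union]
  · congr 1
    ext j
    simp only [mem_compl, mem_map, mem_union, mem_univ, true_and]
    constructor
    · intro h
      by_cases hj : ∃ i, g i = j
      · obtain ⟨i, rfl⟩ := hj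
        exact Or.inr ⟨i, fun hi => h ⟨i, hi, rfl⟩, rfl⟩
      · exact Or.inl hj
    · rintro (h | ⟨i, hi, rfl⟩) ⟨k, hk, hk'⟩
      · exact h ⟨k, hk'⟩
      · exact hi (g.injective hk' ▸ hk)
  · rw [Finset.disjoint_left]
    intro j h h'
    simp only [mem_compl, mem_map, mem_univ, true_and] at h h'
    obtain ⟨i, -, hi⟩ := h'
    exact h ⟨i, hi⟩

theorem eq_update_iff_comp (g : Fin n ↪ Fin N) {a c : Fin N → Fin 3}
    (h : ∀ j, (∀ i, g i ≠ j) → c j = a j) (i : Fin n) (s : Fin 3) :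
    c = update a (g i) s ↔ c ∘ g = update (a ∘ g) i s := by
  constructor
  · rintro rfl
    exact update_comp_eq_of_injective a g.injective i s
  · intro hc
    ext1 j
    by_cases hj : ∃ k, g k = j
    · obtain ⟨k, rfl⟩ := hj
      have := congrFun hc k
      rw [comp_apply] at this
      rw [this]
      by_cases hk : k = i
      · subst hk; simp
      · rw [update_of_ne hk, update_of_ne (g.injective.ne hk), comp_apply]
    · push Not at hj
      rw [h j hj, update_of_ne (hj i).symm]

theorem sum_eq_sum_comp (g : Fin n ↪ Fin N) (f : Fin N → ℂ)
    (h : ∀ j, (∀ i, g i ≠ j) → f j = 0) : ∑ j, f j = ∑ i, f (g i) := by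
  rw [← Finset.sum_map univ g f]
  symm
  apply Finset.sum_subset (Finset.subset_univ _)
  intro j _ hj
  apply h
  simpa using hj

/-- This includes `s = 0`, where `s - 1` wraps around to `2`. Hence a site lowered by a term of
`colOp` really changes, and terms lowering a site outside the range of `g` drop out. -/
theorem sub_one_ne (s : Fin 3) : s - 1 ≠ s := by revert s; decide

theorem prod_dressJump_single {q z : ℂ} {x : Fin n → ℂ} {a c : Fin n → Fin 3} {r : Fin 3}
    (i : Fin n)
    (h : ∀ k, k ≠ i → c k = a k) :
    ∏ k, dressJump q (a k) (c k) z (x k) r = dressJump q (a i) (c i) z (x i) r :=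
  Finset.prod_eq_single i (fun k _ hk => by simp [dressJump, h k hk]) (by simp)

theorem prod_dressJump_pair {q z : ℂ} {x : Fin n → ℂ} {a c : Fin n → Fin 3} {r : Fin 3}
    {i j : Fin n}
    (hij : i ≠ j) (h : ∀ k, k ≠ i → k ≠ j → c k = a k) :
    ∏ k, dressJump q (a k) (c k) z (x k) r =
      dressJump q (a i) (c i) z (x i) r * dressJump q (a j) (c j) z (x j) r := by
  rw [← Finset.prod_pair (f := fun k => dressJump q (a k) (c k) z (x k) r) hij]
  symm
  apply Finset.prod_subset (Finset.subset_univ _)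
  intro k _ hk
  simp only [mem_insert, mem_singleton, not_or] at hk
  simp [dressJump, h k hk.1 hk.2]

theorem eq_update_update_iff_comp (g : Fin n ↪ Fin N) {a c : Fin N → Fin 3}
    (h : ∀ j, (∀ i, g i ≠ j) → c j = a j) (i j : Fin n) (s t : Fin 3) :
    c = update (update a (g i) s) (g j) t ↔ c ∘ g = update (update (a ∘ g) i s) j t := by
  rw [eq_update_iff_comp g, update_comp_eq_of_injective a g.injective i s]
  intro k hk
  rw [update_of_ne (hk i).symm, h k hk]

/-- Sites outside the range of `g` are idle, so each term of the sum lowers sites inside the range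
only. What the idle sites contribute to a term depends only on the jumps from `a` to `c`, which are
the same for all nonzero terms, so it factors out as `outer`. -/
theorem colOp_restrict (L : ColumnData) (q : ℂ) (x : Fin N → ℂ) (g : Fin n ↪ Fin N)
    {a c : Fin N → Fin 3} (h : ∀ j, (∀ i, g i ≠ j) → c j = a j) (k : Fin 3) :
    colOp L q x k a c = outer L q x g a c * colOp L q (x ∘ g) k (a ∘ g) (c ∘ g) := by
  match k with
  | 0 =>
    simp only [colOp, Matrix.of_apply]
    by_cases hc : c = a
    · subst hc
      have := prod_compl_map g ∅ (fun j => L.diag (c j) (x j))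
      simp only [map_empty, compl_empty] at this
      rw [if_pos rfl, if_pos rfl, this]
      simp [outer, dressJump]
    · rw [if_neg hc, if_neg, mul_zero]
      intro hc'
      refine hc (funext fun j => ?_)
      by_cases hj : ∃ k, g k = j
      · obtain ⟨k, rfl⟩ := hj
        exact congrFun hc' k
      · push Not at hj
        exact h j hj
  | 1 =>
    simp only [colOp, Matrix.of_apply, comp_apply]
    rw [sum_eq_sum_comp g, mul_sum]
    · refine sum_congr rfl fun i _ => ?_
      by_cases hc : c = update a (g i) (a (g i) - 1)
      · have hc' := (eq_update_iff_comp g h i _).1 hc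
        rw [if_pos hc, if_pos hc', ← map_singleton, prod_compl_map, outer]
        have hr : ∀ z r, ∏ k, dressJump q (a (g k)) (c (g k)) z (x (g k)) r =
            dress q (a (g i)) z (x (g i)) r := by
          intro z r
          have hk : ∀ k, k ≠ i → c (g k) = a (g k) := fun k hk => by
            simpa [update_of_ne hk] using congrFun hc' k
          have hi : c (g i) = a (g i) - 1 := by simpa using congrFun hc' i
          refine (prod_dressJump_single (x := x ∘ g) (a := a ∘ g) (c := c ∘ g) i hk).trans ?_
          simp [dressJump, hi]
        simp only [hr]
        ring
      · rw [if_neg hc, if_neg (fun h' => hc ((eq_update_iff_comp g h i _).2 h')), mul_zero]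
    · intro j hj
      rw [if_neg]
      intro hc
      have := congrFun hc j
      rw [h j hj, update_self] at this
      exact sub_one_ne _ this.symm
  | 2 =>
    simp only [colOp, Matrix.of_apply, comp_apply]
    rw [mul_add, sum_eq_sum_comp g]
    · congr 1
      · rw [mul_sum]
        refine sum_congr rfl fun i _ => ?_
        by_cases hc : a (g i) = 2 ∧ c = update a (g i) 0
        · have hc' := (eq_update_iff_comp g h i _).1 hc.2
          rw [if_pos hc, if_pos ⟨hc.1, hc'⟩, ← map_singleton, prod_compl_map, outer]
          have hr : ∀ z r, ∏ k, dressJump q (a (g k)) (c (g k)) z (x (g k)) r =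
              dressBoth q z (x (g i)) r := by
            intro z r
            have hk : ∀ k, k ≠ i → c (g k) = a (g k) := fun k hk => by
              simpa [update_of_ne hk] using congrFun hc' k
            have hi : c (g i) = 0 := by simpa using congrFun hc' i
            refine (prod_dressJump_single (x := x ∘ g) (a := a ∘ g) (c := c ∘ g) i hk).trans ?_
            simp [dressJump, hi, hc.1]
          simp only [hr]
          ring
        · rw [if_neg hc, if_neg (fun h' => hc ⟨h'.1, (eq_update_iff_comp g h i _).2 h'.2⟩),
            mul_zero]
      · rw [mul_left_comm]
        congr 1
        rw [mul_sum, sum_eq_sum_comp g]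
        · refine sum_congr rfl fun i _ => ?_
          rw [mul_sum, sum_eq_sum_comp g]
          · refine sum_congr rfl fun j _ => ?_
            by_cases hc : g i ≠ g j ∧
              c = update (update a (g i) (a (g i) - 1)) (g j) (a (g j) - 1)
            · have hij : i ≠ j := fun h => hc.1 (congrArg g h)
              have hc' := (eq_update_update_iff_comp g h i j _ _).1 hc.2
              have hm : ({g i, g j} : Finset (Fin N)) = ({i, j} : Finset (Fin n)).map g := by
                simp
              rw [if_pos hc, if_pos ⟨hij, hc'⟩, hm, prod_compl_map, outer]
              have hr : ∀ z r, ∏ k, dressJump q (a (g k)) (c (g k)) z (x (g k)) r =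
                  dress q (a (g i)) z (x (g i)) r * dress q (a (g j)) z (x (g j)) r := by
                intro z r
                have hk : ∀ k, k ≠ i → k ≠ j → c (g k) = a (g k) := fun k hk hk' => by
                  simpa [update_of_ne hk, update_of_ne hk'] using congrFun hc' k
                have hi : c (g i) = a (g i) - 1 := by
                  simpa [update_of_ne hij] using congrFun hc' i
                have hj : c (g j) = a (g j) - 1 := by simpa using congrFun hc' j
                refine (prod_dressJump_pair (x := x ∘ g) (a := a ∘ g) (c := c ∘ g)
                  hij hk).trans ?_
                simp [dressJump, hi, hj]
              simp only [hr]
              ring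
            · rw [if_neg hc, if_neg, mul_zero]
              exact fun h' => hc ⟨g.injective.ne h'.1,
                (eq_update_update_iff_comp g h i j _ _).2 h'.2⟩
          · intro j hj
            rw [if_neg]
            rintro ⟨-, hc⟩
            have := congrFun hc j
            rw [h j hj, update_self] at this
            exact sub_one_ne _ this.symm
        · intro i hi
          refine sum_eq_zero fun j _ => if_neg ?_
          rintro ⟨hij, hc⟩
          have := congrFun hc i
          rw [h i hi, update_of_ne hij, update_self] at this
          exact sub_one_ne _ this.symm
    · intro j hj
      rw [if_neg]
      rintro ⟨h2, hc⟩
      have := congrFun hc j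
      rw [h j hj, update_self, h2] at this
      exact absurd this (by decide)

theorem le_and_sum_eq_of_eq_update {a c : Fin N → Fin 3} {i : Fin N} {t : Fin 3} {m : ℕ}
    (ht : (t : ℕ) + m = a i) (hc : c = update a i t) :
    (∀ j, c j ≤ a j) ∧ ∑ j, (a j : ℕ) = ∑ j, (c j : ℕ) + m := by
  subst hc
  constructor
  · intro j
    by_cases hj : j = i
    · subst hj
      rw [update_self, Fin.le_def]
      omega
    · rw [update_of_ne hj]
  · have h : ∀ f : Fin N → ℕ, ∑ j, f j = f i + ∑ j ∈ univ.erase i, f j := fun f =>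
      (Finset.add_sum_erase _ _ (mem_univ i)).symm
    rw [h, h fun j => (update a i t j : ℕ), update_self]
    have h' : ∑ j ∈ univ.erase i, (update a i t j : ℕ) = ∑ j ∈ univ.erase i, (a j : ℕ) :=
      sum_congr rfl fun j hj => by rw [update_of_ne (ne_of_mem_erase hj)]
    omega

theorem val_sub_one {s : Fin 3} (hs : s ≠ 0) : ((s - 1 : Fin 3) : ℕ) + 1 = s := by
  revert s; decide

/-- The wrap-around `0 - 1 = 2` in `Fin 3` is excluded because `single_zero`, `pair_zero_left` and
`pair_zero_right` make the corresponding weights vanish. -/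
theorem le_and_sum_eq_of_colOp_ne_zero {L : ColumnData} {q : ℂ} {x : Fin N → ℂ} {k : Fin 3}
    {a c : Fin N → Fin 3} (h : colOp L q x k a c ≠ 0) :
    (∀ j, c j ≤ a j) ∧ ∑ j, (a j : ℕ) = ∑ j, (c j : ℕ) + k := by
  match k with
  | 0 =>
    simp only [colOp, Matrix.of_apply, ne_eq, ite_eq_right_iff, Classical.not_imp] at h
    rw [h.1]
    simp
  | 1 =>
    simp only [colOp, Matrix.of_apply] at h
    obtain ⟨i, -, hi⟩ := exists_ne_zero_of_sum_ne_zero h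
    simp only [ne_eq, ite_eq_right_iff, Classical.not_imp] at hi
    have h0 : a i ≠ 0 := fun h0 => hi.2 (by rw [h0, L.single_zero, zero_mul])
    exact le_and_sum_eq_of_eq_update (val_sub_one h0) hi.1
  | 2 =>
    simp only [colOp, Matrix.of_apply] at h
    by_cases hd : (∑ i, if a i = 2 ∧ c = update a i 0 then
        L.double (x i) * ∏ j ∈ {i}ᶜ, L.diag (a j) (x j) * dressBoth q (x j) (x i) (a j)
        else 0) = 0
    · rw [hd, zero_add] at h
      obtain ⟨i, -, hi⟩ := exists_ne_zero_of_sum_ne_zero (right_ne_zero_of_mul h)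
      obtain ⟨j, -, hj⟩ := exists_ne_zero_of_sum_ne_zero hi
      simp only [ne_eq, ite_eq_right_iff, Classical.not_imp] at hj
      obtain ⟨⟨hij, hc⟩, hj⟩ := hj
      have hi0 : a i ≠ 0 := fun h0 => hj (by rw [h0, L.pair_zero_left, zero_mul])
      have hj0 : a j ≠ 0 := fun h0 => hj (by rw [h0, L.pair_zero_right, zero_mul])
      have h1 := le_and_sum_eq_of_eq_update (val_sub_one hi0)
        (rfl : update a i (a i - 1) = update a i (a i - 1))
      have h2 := le_and_sum_eq_of_eq_update (m := 1)
        (by rw [update_of_ne (Ne.symm hij)]; exact val_sub_one hj0) hc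
      refine ⟨fun k => (h2.1 k).trans (h1.1 k), ?_⟩
      rw [h1.2, h2.2]
      rfl
    · obtain ⟨i, -, hi⟩ := exists_ne_zero_of_sum_ne_zero hd
      simp only [ne_eq, ite_eq_right_iff, Classical.not_imp] at hi
      exact le_and_sum_eq_of_eq_update (by rw [hi.1.1]; rfl) hi.1.2

/-- The cocycle property. The only composite case is 2 → 1 → 0, where it is the identity d^• d^∘ =
d^{•∘}; the hypotheses are the nonvanishing of the denominators that cancel there. -/
theorem dressJump_mul {q x z : ℂ} (hq : q ≠ -1) (h : x ≠ z) (h₁ : x ≠ q * z) (h₂ : z ≠ q * x)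
    {s t u : Fin 3} (hst : t ≤ s) (htu : u ≤ t) (r : Fin 3) :
    dressJump q s t x z r * dressJump q t u x z r = dressJump q s u x z r := by
  have hq' : 1 + q ≠ 0 := fun h => hq (by linear_combination h)
  have h' : x - z ≠ 0 := sub_ne_zero.2 h
  have h₁' : x - q * z ≠ 0 := sub_ne_zero.2 h₁
  have h₂' : q * x - z ≠ 0 := sub_ne_zero.2 h₂.symm
  have key : ∀ r, dress q 2 x z r * dress q 1 x z r = dressBoth q x z r := by
    intro r
    fin_cases r
    · simp [dress, dressBoth]
    · simp only [dress, dressBoth, Fin.mk_one, Matrix.cons_val_one, Matrix.cons_val_zero]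
      field_simp
    · simp only [dress, dressBoth, Fin.reduceFinMk, Matrix.cons_val]
      field_simp
  have hd : ∀ s t u : Fin 3, t ≤ s → u ≤ t → t = s ∨ u = t ∨ (s = 2 ∧ t = 1 ∧ u = 0) := by decide
  rcases hd s t u hst htu with rfl | rfl | ⟨rfl, rfl, rfl⟩
  · simp [dressJump]
  · simp [dressJump]
  · rw [show dressJump q 2 1 x z r = dress q 2 x z r from rfl,
      show dressJump q 1 0 x z r = dress q 1 x z r from rfl, key]
    rfl

/-- The genericity condition on the spectral parameters of the sites. -/
def Generic (q : ℂ) (x : Fin N → ℂ) : Prop := ∀ i j, i ≠ j → x i ≠ x j ∧ x i ≠ q * x j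

/-- An intermediate state `c` lies between `b` and `a`, so it is frozen wherever `a` and `b` agree,
and the sum runs over the states of the active sites alone. By `dressJump_mul` the idle sites give a
factor free of `c`; it is symmetric in `L` and `L'`. -/
theorem colOp_mul_restrict {L L' : ColumnData} {q : ℂ} (hq : q ≠ -1) {x : Fin N → ℂ}
    (hx : Generic q x) (g : Fin n ↪ Fin N) {a b : Fin N → Fin 3}
    (h : ∀ j, (∀ i, g i ≠ j) → b j = a j) (k l : Fin 3) :
    (colOp L q x k * colOp L' q x l) a b =
      (∏ j ∈ (univ.map g)ᶜ, L.diag (a j) (x j) * L'.diag (a j) (x j) *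
        ∏ i, dressJump q (a (g i)) (b (g i)) (x j) (x (g i)) (a j)) *
      (colOp L q (x ∘ g) k * colOp L' q (x ∘ g) l) (a ∘ g) (b ∘ g) := by
  simp only [Matrix.mul_apply]
  rw [mul_sum]
  symm
  refine Finset.sum_of_injOn (fun c => extend g c a) ?_ (by simp) ?_ ?_
  · intro c _ c' _ hcc
    ext1 i
    have := congrFun hcc (g i)
    simpa [g.injective.extend_apply] using this
  · intro c _ hc
    by_contra hne
    apply hc
    have h1 := le_and_sum_eq_of_colOp_ne_zero (left_ne_zero_of_mul hne)
    have h2 := le_and_sum_eq_of_colOp_ne_zero (right_ne_zero_of_mul hne)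
    refine ⟨c ∘ g, by simp, funext fun j => ?_⟩
    by_cases hj : ∃ i, g i = j
    · obtain ⟨i, rfl⟩ := hj
      simp [g.injective.extend_apply]
    · simp only [extend_apply' _ _ _ hj]
      push Not at hj
      exact le_antisymm ((h j hj).symm.le.trans (h2.1 j)) (h1.1 j)
  · intro c _
    have hoff : ∀ j, (∀ i, g i ≠ j) → extend g c a j = a j := fun j hj =>
      extend_apply' _ _ _ (by simpa using hj)
    have hon : extend g c a ∘ g = c := funext fun i => g.injective.extend_apply _ _ _
    rw [colOp_restrict L q x g hoff, colOp_restrict L' q x g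
      (fun j hj => by rw [hoff j hj, h j hj]), hon]
    by_cases h0 : colOp L q (x ∘ g) k (a ∘ g) c * colOp L' q (x ∘ g) l c (b ∘ g) = 0
    · rw [h0, mul_zero, mul_mul_mul_comm, h0, mul_zero]
    · have h1 := (le_and_sum_eq_of_colOp_ne_zero (left_ne_zero_of_mul h0)).1
      have h2 := (le_and_sum_eq_of_colOp_ne_zero (right_ne_zero_of_mul h0)).1
      rw [mul_mul_mul_comm]
      congr 1
      rw [outer, outer, ← prod_mul_distrib]
      refine prod_congr rfl fun j hj => ?_
      have hj' : ∀ i, g i ≠ j := by simpa using hj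
      rw [hoff j hj', mul_mul_mul_comm, ← prod_mul_distrib]
      congr 1
      refine prod_congr rfl fun i _ => ?_
      rw [g.injective.extend_apply]
      exact (dressJump_mul hq (hx _ _ (hj' i).symm).1 (hx _ _ (hj' i).symm).2
        (hx _ _ (hj' i)).2 (h1 i) (h2 i) _).symm

/-- A bilinear exchange relation between two families of column operators holds on any number of
sites as soon as it holds on at most `k + l` sites, all of which change their state and whose final
states are sorted. -/
theorem exchange_of_active {L L' : ColumnData} {q : ℂ} (hq : q ≠ -1) (k l : Fin 3)
    (w : Fin 3 → Fin 3 → ℂ) (hw : ∀ i j, w i j ≠ 0 → (i : ℕ) + j = k + l) (P : ℂ → Prop)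
    (H : ∀ (n : ℕ) (x : Fin n → ℂ), n ≤ (k : ℕ) + l → Generic q x → (∀ i, P (x i)) →
      ∀ a b : Fin n → Fin 3, Monotone a → (∀ i, b i < a i) →
        ∑ i, (a i : ℕ) = ∑ i, (b i : ℕ) + (k + l) →
        (colOp L q x k * (colOp L' q x l * 1) : Matrix _ _ ℂ) a b =
          ∑ i, ∑ j, w i j * (colOp L' q x j * (colOp L q x i * 1) : Matrix _ _ ℂ) a b)
    {x : Fin N → ℂ} (hx : Generic q x) (hP : ∀ i, P (x i)) :
    colOp L q x k * colOp L' q x l =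
      ∑ i, ∑ j, w i j • (colOp L' q x j * colOp L q x i) := by
  -- The factor `1` in `H` serves only the verifications: the row expansions of `colOp * M` can then
  -- be applied twice, ending at entries of the identity matrix.
  simp only [Matrix.mul_one] at H
  ext a b
  simp only [Matrix.sum_apply, Matrix.smul_apply, smul_eq_mul]
  by_cases hab : (∀ i, b i ≤ a i) ∧ ∑ i, (a i : ℕ) = ∑ i, (b i : ℕ) + (k + l)
  · let S : Finset (Fin N) := {i | b i ≠ a i}
    let e := S.orderEmbOfFin rfl
    -- The active sites may be enumerated in any order; sorting by final state leaves fewer cases to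
    -- verify.
    let σ := Tuple.sort (a ∘ e)
    let g : Fin S.card ↪ Fin N := σ.toEmbedding.trans e.toEmbedding
    have hmono : Monotone (a ∘ g) := Tuple.monotone_sort (a ∘ e)
    have hg : ∀ j, (∀ i, g i ≠ j) → b j = a j := by
      intro j hj
      by_contra hne
      have : j ∈ Set.range e := by
        rw [range_orderEmbOfFin]; simpa [S] using hne
      obtain ⟨i, hi⟩ := this
      exact hj (σ.symm i) (by simpa [g] using hi)
    have hlt : ∀ i, (b ∘ g) i < (a ∘ g) i := by
      intro i
      have : g i ∈ S := S.orderEmbOfFin_mem rfl (σ i)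
      exact lt_of_le_of_ne (hab.1 _) (by simpa [S] using this)
    have hsum : ∑ i, ((a ∘ g) i : ℕ) = ∑ i, ((b ∘ g) i : ℕ) + (k + l) := by
      have h1 : ∀ f : Fin N → ℕ, ∑ i, f i = ∑ i, f (g i) + ∑ i ∈ (univ.map g)ᶜ, f i := by
        intro f
        rw [← sum_map univ g f, sum_add_sum_compl]
      have h2 := hab.2
      rw [h1, h1 fun i => (b i : ℕ)] at h2
      have h3 : ∑ i ∈ (univ.map g)ᶜ, (b i : ℕ) = ∑ i ∈ (univ.map g)ᶜ, (a i : ℕ) :=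
        sum_congr rfl fun i hi => by rw [hg i (by simpa using hi)]
      simp only [comp_apply]
      omega
    -- Each active site loses at least one unit and the total loss is `k + l`.
    have hcard : S.card ≤ (k : ℕ) + l := by
      have : ∑ i : Fin S.card, (((b ∘ g) i : ℕ) + 1) ≤ ∑ i, ((a ∘ g) i : ℕ) :=
        sum_le_sum fun i _ => hlt i
      rw [sum_add_distrib] at this
      simp only [sum_const, card_univ, Fintype.card_fin, smul_eq_mul, mul_one] at this
      omega
    rw [colOp_mul_restrict hq hx g hg, H _ (x ∘ g) hcard
      (fun i j hij => hx _ _ (g.injective.ne hij)) (fun i => hP _) _ _ hmono hlt hsum, mul_sum]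
    refine sum_congr rfl fun i _ => ?_
    rw [mul_sum]
    refine sum_congr rfl fun j _ => ?_
    rw [colOp_mul_restrict hq hx g hg, mul_left_comm]
    -- The idle factors of the two orders of multiplication differ only by commuting the scalars
    -- `L.diag` and `L'.diag`.
    simp only [mul_comm (L.diag _ _)]
  · have h0 : ∀ (A B : ColumnData) (i j : Fin 3), (i : ℕ) + j = k + l →
        (colOp A q x i * colOp B q x j) a b = 0 := by
      intro A B i j hij
      rw [Matrix.mul_apply]
      refine sum_eq_zero fun c _ => ?_
      by_contra hne
      have h1 := le_and_sum_eq_of_colOp_ne_zero (left_ne_zero_of_mul hne)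
      have h2 := le_and_sum_eq_of_colOp_ne_zero (right_ne_zero_of_mul hne)
      refine hab ⟨fun i => (h2.1 i).trans (h1.1 i), ?_⟩
      omega
    rw [h0 L L' k l rfl]
    refine (sum_eq_zero fun i _ => sum_eq_zero fun j _ => ?_).symm
    by_cases hij : w i j = 0
    · rw [hij, zero_mul]
    · rw [h0 L' L j i (by have := hw i j hij; omega), mul_zero]

/-! ### The operators Γ_k as column operators, and their permutation symmetry -/

/-- The weights of `e_{ij}^{uv}(z)`, with the removable factors cancelled. -/
noncomputable def pairWeight (q z : ℂ) : Fin 3 → Fin 3 → ℂ → ℂ → ℂ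
  | 1, 1, x, y =>
    (1 - q ^ 2) * (x * y + q ^ 2 * x * y - q ^ 2 * x * z - q ^ 2 * y * z) * z /
      ((x - q ^ 2 * z) * (y - q ^ 2 * z))
  | 2, 1, x, y =>
    (1 - q ^ 2) ^ 2 * (x * y + q ^ 2 * x * y - q ^ 2 * x * z - q ^ 3 * y * z) * (x - z) * z /
      ((x - y) * ((x - q ^ 2 * z) * (x - q ^ 3 * z)) * (y - q ^ 2 * z))
  | 1, 2, x, y =>
    (1 - q ^ 2) ^ 2 * (x * y + q ^ 2 * x * y - q ^ 3 * x * z - q ^ 2 * y * z) * (y - z) * z /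
      ((y - x) * ((y - q ^ 2 * z) * (y - q ^ 3 * z)) * (x - q ^ 2 * z))
  | 2, 2, x, y =>
    q * (1 - q ^ 2) ^ 3 * (x * y + q ^ 2 * x * y - q ^ 3 * x * z - q ^ 3 * y * z) *
      (x - z) * (y - z) * z /
      (((x - q * y) * (y - q * x)) * ((x - q ^ 2 * z) * (x - q ^ 3 * z)) *
        ((y - q ^ 2 * z) * (y - q ^ 3 * z)))
  | _, _, _, _ => 0

/-- The local weights of the twisted column operators `Γ_k(z)`. -/
noncomputable def gammaData (q z : ℂ) : ColumnData where
  diag s x := ![1, (x - z) / (x - q ^ 2 * z),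
      (x - z) * (x - q * z) / ((x - q ^ 2 * z) * (x - q ^ 3 * z))] s
  single s x := ![0, (1 - q ^ 2) * z / (x - q ^ 2 * z),
      q * (1 - q) ^ 2 * (1 + q) * (x - z) * z / ((x - q ^ 2 * z) * (x - q ^ 3 * z))] s
  double x := (1 - q ^ 2) * (x + q ^ 2 * x - q ^ 2 * z - q ^ 3 * z) * z /
      ((x - q ^ 2 * z) * (x - q ^ 3 * z))
  pair := pairWeight q z
  single_zero _ := rfl
  pair_zero_left s x y := by fin_cases s <;> rfl
  pair_zero_right s x y := by fin_cases s <;> rfl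
  pair_symm s t x y := by
    fin_cases s <;> fin_cases t <;>
      first | rfl | (simp only [pairWeight, Fin.mk_one, Fin.reduceFinMk]; ring)

/-- The state to which a site is raised by `e^∘` or `e^•`. -/
def Dot.state : Dot → Fin 3
  | .circ => 1
  | .bull => 2

theorem sum_dot (f : Dot → ℂ) : ∑ u, f u = f .circ + f .bull := by
  change ∑ u ∈ {Dot.circ, Dot.bull}, f u = _
  rw [sum_pair (by decide)]

theorem d_eq (q x z : ℂ) : d q x z = Matrix.diagonal fun s => (gammaData q z).diag s x := rfl

theorem dDot_eq (q : ℂ) (u : Dot) (x z : ℂ) :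
    dDot q u x z = Matrix.diagonal (dress q u.state x z) := by
  cases u <;> rfl

theorem dBoth_eq (q x z : ℂ) : dBoth q x z = Matrix.diagonal (dressBoth q x z) := rfl

theorem eDot_apply (q : ℂ) (u : Dot) (x z : ℂ) (s t : Fin 3) :
    eDot q u x z s t =
      if s = u.state then (if t = s - 1 then (gammaData q z).single u.state x else 0) else 0 := by
  cases u <;> fin_cases s <;> fin_cases t <;> simp [eDot, gammaData, Dot.state]

theorem eBoth_apply (q x z : ℂ) (s t : Fin 3) :
    eBoth q x z s t = if s = 2 ∧ t = 0 then (gammaData q z).double x else 0 := by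
  fin_cases s <;> fin_cases t <;> simp [eBoth, gammaData]

theorem pairCoeff_mul {q : ℂ} (hq₀ : q ≠ 0) (hq₁ : q ≠ -1) (u v : Dot) (x y z : ℂ) :
    pairCoeff q u v x y z *
        ((gammaData q z).single u.state x * (gammaData q z).single v.state y) =
      pairWeight q z u.state v.state x y := by
  -- At `z = 0` and at `q = 1` the weights `single` vanish, so both sides are zero whatever value
  -- the division in `pairCoeff` takes.
  by_cases hz : z = 0
  · subst hz
    cases u <;> cases v <;> simp [gammaData, Dot.state, pairWeight]
  by_cases hq : q = 1
  · subst hq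
    cases u <;> cases v <;> simp [gammaData, Dot.state, pairWeight]
  have h1 : 1 - q ≠ 0 := fun h => hq (by linear_combination -h)
  have h2 : 1 + q ≠ 0 := fun h => hq₁ (by linear_combination h)
  have h3 : 1 - q ^ 2 = (1 - q) * (1 + q) := by ring
  -- The denominators depending on `x` and `y` occur identically on both sides and are carried along
  -- as formal inverses, so only `z`, `q`, `1 - q` and `1 + q` have to be nonzero.
  cases u <;> cases v <;>
    simp only [gammaData, Dot.state, pairWeight, pairCoeff, bullCircCoeff, Matrix.cons_val, h3,
      div_eq_mul_inv, mul_inv] <;> (field_simp; try ring)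

theorem tensor_ite_apply (i : Fin N) (M : Matrix (Fin 3) (Fin 3) ℂ) (D : Fin N → Fin 3 → ℂ)
    (a c : Fin N → Fin 3) :
    tensor (fun j => if j = i then M else Matrix.diagonal (D j)) a c =
      if ∀ j, j ≠ i → c j = a j then M (a i) (c i) * ∏ j ∈ {i}ᶜ, D j (a j) else 0 := by
  rw [tensor, Matrix.of_apply, Fintype.prod_eq_mul_prod_compl i, if_pos rfl]
  have h : ∏ j ∈ {i}ᶜ, (if j = i then M else Matrix.diagonal (D j)) (a j) (c j) =
      ∏ j ∈ {i}ᶜ, if c j = a j then D j (a j) else 0 := by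
    refine prod_congr rfl fun j hj => ?_
    have hj' : j ≠ i := by simpa using hj
    rw [if_neg hj', Matrix.diagonal_apply]
    simp only [eq_comm]
  rw [h, prod_ite_zero]
  simp

theorem tensor_ite_ite_apply {i j : Fin N} (hij : i ≠ j) (M M' : Matrix (Fin 3) (Fin 3) ℂ)
    (D : Fin N → Fin 3 → ℂ) (a c : Fin N → Fin 3) :
    tensor (fun k => if k = i then M else if k = j then M' else Matrix.diagonal (D k)) a c =
      if ∀ k, k ≠ i → k ≠ j → c k = a k then
        M (a i) (c i) * M' (a j) (c j) * ∏ k ∈ {i, j}ᶜ, D k (a k) else 0 := by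
  rw [tensor, Matrix.of_apply, ← prod_mul_prod_compl {i, j}, prod_pair hij, if_pos rfl,
    if_neg hij.symm, if_pos rfl]
  have h : ∏ k ∈ {i, j}ᶜ, (if k = i then M else if k = j then M' else Matrix.diagonal (D k))
      (a k) (c k) = ∏ k ∈ {i, j}ᶜ, if c k = a k then D k (a k) else 0 := by
    refine prod_congr rfl fun k hk => ?_
    have hk' : k ≠ i ∧ k ≠ j := by simpa using hk
    rw [if_neg hk'.1, if_neg hk'.2, Matrix.diagonal_apply]
    simp only [eq_comm]
  rw [h, prod_ite_zero]
  simp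

theorem eq_update_iff_forall {a c : Fin N → Fin 3} {i : Fin N} {s : Fin 3} :
    c = update a i s ↔ c i = s ∧ ∀ j, j ≠ i → c j = a j := eq_update_iff

theorem eq_update_update_iff_forall {a c : Fin N → Fin 3} {i j : Fin N} (hij : i ≠ j)
    {s t : Fin 3} :
    c = update (update a i s) j t ↔ (c i = s ∧ c j = t) ∧ ∀ k, k ≠ i → k ≠ j → c k = a k := by
  rw [eq_update_iff]
  constructor
  · rintro ⟨hj, h⟩
    refine ⟨⟨by simpa using h i hij, hj⟩, fun k hki hkj => by rw [h k hkj, update_of_ne hki]⟩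
  · rintro ⟨⟨hi, hj⟩, h⟩
    refine ⟨hj, fun k hk => ?_⟩
    by_cases hki : k = i
    · subst hki; simpa using hi
    · rw [update_of_ne hki, h k hki hk]

/-- This passes between the sum over `i < j` defining Γ_2 and the sum over ordered pairs in `colOp`,
where the symmetry under permutations is manifest. -/
theorem sum_sum_Ioi_of_symm (f : Fin N → Fin N → ℂ) (hf : ∀ i j, i ≠ j → f i j = f j i) :
    ∑ i, ∑ j ∈ Ioi i, f i j = 2⁻¹ * ∑ i, ∑ j, if i ≠ j then f i j else 0 := by
  have h1 : ∑ i, ∑ j, (if i ≠ j then f i j else 0) =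
      ∑ i, ∑ j, (if i < j then f i j else 0) + ∑ i, ∑ j, (if j < i then f i j else 0) := by
    simp only [← sum_add_distrib]
    refine sum_congr rfl fun i _ => sum_congr rfl fun j _ => ?_
    rcases lt_trichotomy i j with h | h | h
    · simp [h, h.ne, h.not_gt]
    · simp [h]
    · simp [h, h.ne', h.not_gt]
  have h2 : ∑ i, ∑ j, (if j < i then f i j else 0) = ∑ i, ∑ j, (if i < j then f i j else 0) := by
    rw [sum_comm]
    refine sum_congr rfl fun i _ => sum_congr rfl fun j _ => ?_
    split_ifs with h
    · exact hf _ _ h.ne'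
    · rfl
  have h3 : ∑ i, ∑ j ∈ Ioi i, f i j = ∑ i, ∑ j, (if i < j then f i j else 0) := by
    refine sum_congr rfl fun i _ => ?_
    rw [← sum_filter]
    congr 1
    ext j
    simp
  rw [h1, h2, h3]
  ring

theorem pairCoeff_symm (q : ℂ) (u v : Dot) (x y z : ℂ) :
    pairCoeff q u v x y z = pairCoeff q v u y x z := by
  cases u <;> cases v <;> simp only [pairCoeff] <;> ring

theorem Gamma_eq_colOp {q : ℂ} (hq₀ : q ≠ 0) (hq₁ : q ≠ -1) (x : Fin N → ℂ) (k : Fin 3) (z : ℂ) :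
    Gamma q x k z = colOp (gammaData q z) q x k := by
  ext a c
  match k with
  | 0 =>
    simp only [Gamma, colOp, tensor, Matrix.of_apply, d_eq, Matrix.diagonal_apply]
    rw [prod_ite_zero]
    simp only [mem_univ, true_imp_iff, funext_iff, eq_comm]
  | 1 =>
    simp only [Gamma, colOp, Matrix.of_apply, Matrix.sum_apply, d_eq, dDot_eq,
      Matrix.diagonal_mul_diagonal, tensor_ite_apply, eDot_apply]
    rw [sum_comm]
    refine sum_congr rfl fun i _ => ?_
    simp only [eq_update_iff_forall, sum_dot, Dot.state]
    by_cases h : ∀ j, j ≠ i → c j = a j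
    · by_cases hc : c i = a i - 1
      · simp only [if_pos h, hc, true_and]
        generalize ha : a i = s
        fin_cases s <;> simp [(gammaData q z).single_zero]
      · simp [hc]
    · simp [h]
  | 2 =>
    simp only [Gamma, colOp, Matrix.of_apply, Matrix.add_apply]
    congr 1
    · simp only [Matrix.sum_apply, d_eq, dBoth_eq, Matrix.diagonal_mul_diagonal,
        tensor_ite_apply, eBoth_apply, eq_update_iff_forall]
      refine sum_congr rfl fun i _ => ?_
      simp only [ite_mul, zero_mul]
      rw [← ite_and]
      refine if_congr ?_ rfl rfl
      tauto
    · simp only [Matrix.sum_apply, Matrix.smul_apply, smul_eq_mul, d_eq, dDot_eq,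
        Matrix.diagonal_mul_diagonal]
      have hs : ∀ f : Dot → Dot → Fin N → Fin N → ℂ,
          ∑ u, ∑ v, ∑ i, ∑ j ∈ Ioi i, f u v i j = ∑ i, ∑ j ∈ Ioi i, ∑ u, ∑ v, f u v i j := by
        intro f
        simp only [sum_dot, sum_add_distrib]
      rw [hs, sum_sum_Ioi_of_symm]
      · congr 1
        refine sum_congr rfl fun i _ => sum_congr rfl fun j _ => ?_
        by_cases hij : i ≠ j
        · rw [if_pos hij]
          simp only [tensor_ite_ite_apply hij, eq_update_update_iff_forall hij, eDot_apply]
          by_cases h : ∀ k, k ≠ i → k ≠ j → c k = a k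
          · by_cases hc : c i = a i - 1 ∧ c j = a j - 1
            · rw [if_pos ⟨hij, hc, h⟩]
              have hp : (gammaData q z).pair = pairWeight q z := rfl
              -- At most one pair of dots contributes, the one whose states are `s` and `t`; if one
              -- of these is `0` there is none, and `pairWeight` vanishes as well.
              have key : ∀ s t : Fin 3, ∀ P : Fin 3 → Fin 3 → ℂ, (∑ u : Dot, ∑ v : Dot,
                  pairCoeff q u v (x i) (x j) z *
                    ((if s = u.state then (gammaData q z).single u.state (x i) else 0) *
                    (if t = v.state then (gammaData q z).single v.state (x j) else 0) *
                    P u.state v.state)) = pairWeight q z s t (x i) (x j) * P s t := by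
                intro s t P
                simp only [sum_dot, Dot.state]
                have h := fun u v => pairCoeff_mul hq₀ hq₁ u v (x i) (x j) z
                have h11 := h .circ .circ
                have h12 := h .circ .bull
                have h21 := h .bull .circ
                have h22 := h .bull .bull
                simp only [Dot.state] at h11 h12 h21 h22
                have h0 : ∀ s, pairWeight q z s 0 (x i) (x j) = 0 := fun s => by
                  fin_cases s <;> rfl
                have h0' : ∀ s, pairWeight q z 0 s (x i) (x j) = 0 := fun s => by
                  fin_cases s <;> rfl
                fin_cases s <;> fin_cases t <;>
                  simp [← mul_assoc, ← h11, ← h12, ← h21, ← h22, h0, h0']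
              rw [hp, ← key (a i) (a j) (fun s t => ∏ k ∈ {i, j}ᶜ, (gammaData q z).diag (a k) (x k) *
                (dress q s (x k) (x i) (a k) * dress q t (x k) (x j) (a k)))]
              simp only [hc.1, hc.2, if_true, if_pos h, mul_assoc]
            · rw [if_neg fun h' => hc h'.2.1]
              rw [not_and_or] at hc
              rcases hc with hc | hc <;> simp [hc]
          · simp [h]
        · simp [hij]
      · intro i j hij
        rw [sum_comm]
        refine sum_congr rfl fun v _ => sum_congr rfl fun u _ => ?_
        rw [tensor_ite_ite_apply hij, tensor_ite_ite_apply hij.symm, pairCoeff_symm, pair_comm i j]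
        congr 1
        refine if_congr ⟨fun h k hj hi => h k hi hj, fun h k hi hj => h k hj hi⟩ ?_ rfl
        rw [mul_comm (eDot _ _ _ _ _ _)]
        congr 1
        exact prod_congr rfl fun k _ => by ring

/-- A permutation is an embedding with no site outside its range, so `colOp_restrict` applies and
`outer` is an empty product. -/
theorem Gamma_comp_perm {q : ℂ} (hq₀ : q ≠ 0) (hq₁ : q ≠ -1) (x : Fin N → ℂ) (k : Fin 3) (z : ℂ)
    (σ : Equiv.Perm (Fin N)) (a b : Fin N → Fin 3) :
    Gamma q (x ∘ σ) k z (a ∘ σ) (b ∘ σ) = Gamma q x k z a b := by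
  rw [Gamma_eq_colOp hq₀ hq₁, Gamma_eq_colOp hq₀ hq₁, colOp_restrict _ q x σ.toEmbedding]
  · simp [outer]
  · intro j hj
    exact absurd (σ.apply_symm_apply j) (hj (σ.symm j))

/-! ### Explicit row expansions on one, two and three sites -/

theorem colOp_zero_mul (L : ColumnData) (q : ℂ) (x : Fin N → ℂ)
    (M : Matrix (Fin N → Fin 3) (Fin N → Fin 3) ℂ) (a b : Fin N → Fin 3) :
    (colOp L q x 0 * M) a b = (∏ j, L.diag (a j) (x j)) * M a b := by
  simp [Matrix.mul_apply, colOp]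

theorem colOp_one_mul (L : ColumnData) (q : ℂ) (x : Fin N → ℂ)
    (M : Matrix (Fin N → Fin 3) (Fin N → Fin 3) ℂ) (a b : Fin N → Fin 3) :
    (colOp L q x 1 * M) a b = ∑ i, L.single (a i) (x i) *
      (∏ j ∈ {i}ᶜ, L.diag (a j) (x j) * dress q (a i) (x j) (x i) (a j)) *
      M (update a i (a i - 1)) b := by
  simp only [Matrix.mul_apply, colOp, Matrix.of_apply, sum_mul]
  rw [sum_comm]
  refine sum_congr rfl fun i _ => ?_
  simp only [ite_mul, zero_mul, sum_ite_eq', mem_univ, if_true]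

theorem colOp_two_mul (L : ColumnData) (q : ℂ) (x : Fin N → ℂ)
    (M : Matrix (Fin N → Fin 3) (Fin N → Fin 3) ℂ) (a b : Fin N → Fin 3) :
    (colOp L q x 2 * M) a b = (∑ i, if a i = 2 then L.double (x i) *
      (∏ j ∈ {i}ᶜ, L.diag (a j) (x j) * dressBoth q (x j) (x i) (a j)) *
      M (update a i 0) b else 0) +
      2⁻¹ * ∑ i, ∑ j, if i ≠ j then L.pair (a i) (a j) (x i) (x j) *
        (∏ k ∈ {i, j}ᶜ, L.diag (a k) (x k) *
          (dress q (a i) (x k) (x i) (a k) * dress q (a j) (x k) (x j) (a k))) *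
        M (update (update a i (a i - 1)) j (a j - 1)) b else 0 := by
  simp only [Matrix.mul_apply, colOp, Matrix.of_apply, add_mul, sum_mul, sum_add_distrib, mul_assoc]
  congr 1
  · rw [sum_comm]
    refine sum_congr rfl fun i _ => ?_
    simp only [ite_and, ite_mul, zero_mul, sum_ite_irrel, sum_ite_eq', mem_univ, if_true,
      sum_const_zero, mul_assoc]
  · rw [← mul_sum]
    congr 1
    rw [sum_comm]
    refine sum_congr rfl fun i _ => ?_
    rw [sum_comm]
    refine sum_congr rfl fun j _ => ?_
    simp only [ite_and, ite_mul, zero_mul, sum_ite_irrel, sum_ite_eq', mem_univ, if_true,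
      sum_const_zero, mul_assoc]

theorem colOp_two_mul_of_lt (L : ColumnData) (q : ℂ) (x : Fin N → ℂ)
    (M : Matrix (Fin N → Fin 3) (Fin N → Fin 3) ℂ) (a b : Fin N → Fin 3) :
    (colOp L q x 2 * M) a b = (∑ i, if a i = 2 then L.double (x i) *
      (∏ j ∈ {i}ᶜ, L.diag (a j) (x j) * dressBoth q (x j) (x i) (a j)) *
      M (update a i 0) b else 0) +
      ∑ i, ∑ j ∈ Ioi i, L.pair (a i) (a j) (x i) (x j) *
        (∏ k ∈ {i, j}ᶜ, L.diag (a k) (x k) *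
          (dress q (a i) (x k) (x i) (a k) * dress q (a j) (x k) (x j) (a k))) *
        M (update (update a i (a i - 1)) j (a j - 1)) b := by
  rw [colOp_two_mul, sum_sum_Ioi_of_symm]
  intro i j hij
  rw [L.pair_symm, pair_comm i j, update_comm hij]
  simp only [mul_comm (dress q (a i) _ _ _)]

section Fin

variable {L : ColumnData} {q x₀ x₁ x₂ : ℂ} {a₀ a₁ a₂ : Fin 3}

theorem colOp_zero_mul_fin_one {M : Matrix (Fin 1 → Fin 3) (Fin 1 → Fin 3) ℂ}
    {b : Fin 1 → Fin 3} :
    (colOp L q ![x₀] 0 * M) ![a₀] b = L.diag a₀ x₀ * M ![a₀] b := by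
  simp [colOp_zero_mul]

theorem colOp_one_mul_fin_one {M : Matrix (Fin 1 → Fin 3) (Fin 1 → Fin 3) ℂ}
    {b : Fin 1 → Fin 3} :
    (colOp L q ![x₀] 1 * M) ![a₀] b = L.single a₀ x₀ * M ![a₀ - 1] b := by
  have h : ({0}ᶜ : Finset (Fin 1)) = ∅ := by decide
  have u : ∀ t, update ![a₀] 0 t = ![t] := fun t => by ext i; fin_cases i; rfl
  simp [colOp_one_mul, h, u]

theorem colOp_two_mul_fin_one {M : Matrix (Fin 1 → Fin 3) (Fin 1 → Fin 3) ℂ}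
    {b : Fin 1 → Fin 3} :
    (colOp L q ![x₀] 2 * M) ![a₀] b = if a₀ = 2 then L.double x₀ * M ![0] b else 0 := by
  have h : ({0}ᶜ : Finset (Fin 1)) = ∅ := by decide
  have u : ∀ t, update ![a₀] 0 t = ![t] := fun t => by ext i; fin_cases i; rfl
  simp [colOp_two_mul_of_lt, h, u]

theorem update_fin_two_zero {α : Type*} {a b t : α} : update ![a, b] 0 t = ![t, b] := by
  ext i; fin_cases i <;> rfl

theorem update_fin_two_one {α : Type*} {a b t : α} : update ![a, b] 1 t = ![a, t] := by
  ext i; fin_cases i <;> rfl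

theorem colOp_zero_mul_fin_two {M : Matrix (Fin 2 → Fin 3) (Fin 2 → Fin 3) ℂ}
    {b : Fin 2 → Fin 3} :
    (colOp L q ![x₀, x₁] 0 * M) ![a₀, a₁] b =
      L.diag a₀ x₀ * L.diag a₁ x₁ * M ![a₀, a₁] b := by
  simp [colOp_zero_mul, Fin.prod_univ_two]

theorem colOp_one_mul_fin_two {M : Matrix (Fin 2 → Fin 3) (Fin 2 → Fin 3) ℂ}
    {b : Fin 2 → Fin 3} :
    (colOp L q ![x₀, x₁] 1 * M) ![a₀, a₁] b =
      L.single a₀ x₀ * (L.diag a₁ x₁ * dress q a₀ x₁ x₀ a₁) * M ![a₀ - 1, a₁] b +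
      L.single a₁ x₁ * (L.diag a₀ x₀ * dress q a₁ x₀ x₁ a₀) * M ![a₀, a₁ - 1] b := by
  have h₀ : ({0}ᶜ : Finset (Fin 2)) = {1} := by decide
  have h₁ : ({1}ᶜ : Finset (Fin 2)) = {0} := by decide
  simp [colOp_one_mul, Fin.sum_univ_two, h₀, h₁, update_fin_two_zero, update_fin_two_one]

theorem colOp_two_mul_fin_two {M : Matrix (Fin 2 → Fin 3) (Fin 2 → Fin 3) ℂ}
    {b : Fin 2 → Fin 3} :
    (colOp L q ![x₀, x₁] 2 * M) ![a₀, a₁] b =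
      (if a₀ = 2 then L.double x₀ * (L.diag a₁ x₁ * dressBoth q x₁ x₀ a₁) * M ![0, a₁] b
        else 0) +
      (if a₁ = 2 then L.double x₁ * (L.diag a₀ x₀ * dressBoth q x₀ x₁ a₀) * M ![a₀, 0] b
        else 0) +
      L.pair a₀ a₁ x₀ x₁ * M ![a₀ - 1, a₁ - 1] b := by
  have h₀ : ({0}ᶜ : Finset (Fin 2)) = {1} := by decide
  have h₁ : ({1}ᶜ : Finset (Fin 2)) = {0} := by decide
  have h₂ : ({0, 1}ᶜ : Finset (Fin 2)) = ∅ := by decide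
  have i₀ : (Ioi 0 : Finset (Fin 2)) = {1} := by decide
  have i₁ : (Ioi 1 : Finset (Fin 2)) = ∅ := by decide
  simp only [colOp_two_mul_of_lt, Fin.sum_univ_two, h₀, h₁, i₀, i₁, sum_singleton, h₂,
    update_fin_two_zero, update_fin_two_one, Matrix.cons_val_zero, Matrix.cons_val_one,
    prod_singleton, prod_empty, sum_empty, mul_one, add_zero]

theorem update_fin_three_zero {α : Type*} {a b c t : α} :
    update ![a, b, c] 0 t = ![t, b, c] := by
  ext i; fin_cases i <;> rfl

theorem update_fin_three_one {α : Type*} {a b c t : α} :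
    update ![a, b, c] 1 t = ![a, t, c] := by
  ext i; fin_cases i <;> rfl

theorem update_fin_three_two {α : Type*} {a b c t : α} :
    update ![a, b, c] 2 t = ![a, b, t] := by
  ext i; fin_cases i <;> rfl

theorem colOp_one_mul_fin_three {M : Matrix (Fin 3 → Fin 3) (Fin 3 → Fin 3) ℂ}
    {b : Fin 3 → Fin 3} :
    (colOp L q ![x₀, x₁, x₂] 1 * M) ![a₀, a₁, a₂] b =
      L.single a₀ x₀ * ((L.diag a₁ x₁ * dress q a₀ x₁ x₀ a₁) *
        (L.diag a₂ x₂ * dress q a₀ x₂ x₀ a₂)) * M ![a₀ - 1, a₁, a₂] b +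
      L.single a₁ x₁ * ((L.diag a₀ x₀ * dress q a₁ x₀ x₁ a₀) *
        (L.diag a₂ x₂ * dress q a₁ x₂ x₁ a₂)) * M ![a₀, a₁ - 1, a₂] b +
      L.single a₂ x₂ * ((L.diag a₀ x₀ * dress q a₂ x₀ x₂ a₀) *
        (L.diag a₁ x₁ * dress q a₂ x₁ x₂ a₁)) * M ![a₀, a₁, a₂ - 1] b := by
  have h₀ : ({0}ᶜ : Finset (Fin 3)) = {1, 2} := by decide
  have h₁ : ({1}ᶜ : Finset (Fin 3)) = {0, 2} := by decide
  have h₂ : ({2}ᶜ : Finset (Fin 3)) = {0, 1} := by decide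
  simp [colOp_one_mul, Fin.sum_univ_three, h₀, h₁, h₂, update_fin_three_zero,
    update_fin_three_one, update_fin_three_two]

theorem colOp_two_mul_fin_three {M : Matrix (Fin 3 → Fin 3) (Fin 3 → Fin 3) ℂ}
    {b : Fin 3 → Fin 3} :
    (colOp L q ![x₀, x₁, x₂] 2 * M) ![a₀, a₁, a₂] b =
      (if a₀ = 2 then L.double x₀ * ((L.diag a₁ x₁ * dressBoth q x₁ x₀ a₁) *
        (L.diag a₂ x₂ * dressBoth q x₂ x₀ a₂)) * M ![0, a₁, a₂] b else 0) +
      (if a₁ = 2 then L.double x₁ * ((L.diag a₀ x₀ * dressBoth q x₀ x₁ a₀) *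
        (L.diag a₂ x₂ * dressBoth q x₂ x₁ a₂)) * M ![a₀, 0, a₂] b else 0) +
      (if a₂ = 2 then L.double x₂ * ((L.diag a₀ x₀ * dressBoth q x₀ x₂ a₀) *
        (L.diag a₁ x₁ * dressBoth q x₁ x₂ a₁)) * M ![a₀, a₁, 0] b else 0) +
      (L.pair a₀ a₁ x₀ x₁ * (L.diag a₂ x₂ * (dress q a₀ x₂ x₀ a₂ * dress q a₁ x₂ x₁ a₂)) *
        M ![a₀ - 1, a₁ - 1, a₂] b +
      L.pair a₀ a₂ x₀ x₂ * (L.diag a₁ x₁ * (dress q a₀ x₁ x₀ a₁ * dress q a₂ x₁ x₂ a₁)) *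
        M ![a₀ - 1, a₁, a₂ - 1] b +
      L.pair a₁ a₂ x₁ x₂ * (L.diag a₀ x₀ * (dress q a₁ x₀ x₁ a₀ * dress q a₂ x₀ x₂ a₀)) *
        M ![a₀, a₁ - 1, a₂ - 1] b) := by
  have h₀ : ({0}ᶜ : Finset (Fin 3)) = {1, 2} := by decide
  have h₁ : ({1}ᶜ : Finset (Fin 3)) = {0, 2} := by decide
  have h₂ : ({2}ᶜ : Finset (Fin 3)) = {0, 1} := by decide
  have h₃ : ({0, 1}ᶜ : Finset (Fin 3)) = {2} := by decide
  have h₄ : ({0, 2}ᶜ : Finset (Fin 3)) = {1} := by decide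
  have h₅ : ({1, 2}ᶜ : Finset (Fin 3)) = {0} := by decide
  have i₀ : (Ioi 0 : Finset (Fin 3)) = {1, 2} := by decide
  have i₁ : (Ioi 1 : Finset (Fin 3)) = {2} := by decide
  have i₂ : (Ioi 2 : Finset (Fin 3)) = ∅ := by decide
  have n₁ : (1 : Fin 3) ≠ 2 := by decide
  have n₂ : (0 : Fin 3) ≠ 2 := by decide
  have n₃ : (0 : Fin 3) ≠ 1 := by decide
  simp only [colOp_two_mul_of_lt, Fin.sum_univ_three, i₀, i₁, i₂, sum_singleton,
    sum_pair n₁, h₃, h₄, h₅, h₀, h₁, h₂, prod_pair n₁, prod_pair n₂, prod_pair n₃,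
    prod_singleton, sum_empty, update_fin_three_zero, update_fin_three_one, update_fin_three_two,
    Matrix.cons_val, add_zero]

end Fin

/-! ### The limit z → ∞ and its commutation with Γ_k(y) -/

/-- The limit `z → ∞` of `gammaData q z`, as far as it enters `Γ_0` and `Γ_1`. -/
noncomputable def limitData (q : ℂ) : ColumnData where
  diag s _ := ![1, 1 / q ^ 2, 1 / q ^ 4] s
  single s _ := ![0, -(1 - q ^ 2) / q ^ 2, -((1 - q) ^ 2 * (1 + q)) / q ^ 4] s
  double _ := 0
  pair _ _ _ _ := 0
  single_zero _ := rfl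
  pair_zero_left _ _ _ := rfl
  pair_zero_right _ _ _ := rfl
  pair_symm _ _ _ _ := rfl

theorem exists_vec_two {α : Type*} (f : Fin 2 → α) : ∃ a b, f = ![a, b] :=
  ⟨f 0, f 1, by ext i; fin_cases i <;> rfl⟩

theorem exists_vec_one {α : Type*} (f : Fin 1 → α) : ∃ a, f = ![a] :=
  ⟨f 0, by ext i; fin_cases i; rfl⟩

theorem exists_vec_three {α : Type*} (f : Fin 3 → α) : ∃ a b c, f = ![a, b, c] :=
  ⟨f 0, f 1, f 2, by ext i; fin_cases i <;> rfl⟩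

theorem one_apply_three {a₀ a₁ a₂ b₀ b₁ b₂ : Fin 3} :
    (1 : Matrix (Fin 3 → Fin 3) (Fin 3 → Fin 3) ℂ) ![a₀, a₁, a₂] ![b₀, b₁, b₂] =
      if a₀ = b₀ ∧ a₁ = b₁ ∧ a₂ = b₂ then 1 else 0 := by
  simp [Matrix.one_apply]

theorem one_apply_two {a₀ a₁ b₀ b₁ : Fin 3} :
    (1 : Matrix (Fin 2 → Fin 3) (Fin 2 → Fin 3) ℂ) ![a₀, a₁] ![b₀, b₁] =
      if a₀ = b₀ ∧ a₁ = b₁ then 1 else 0 := by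
  simp [Matrix.one_apply]

theorem one_apply_one {a₀ b₀ : Fin 3} :
    (1 : Matrix (Fin 1 → Fin 3) (Fin 1 → Fin 3) ℂ) ![a₀] ![b₀] = if a₀ = b₀ then 1 else 0 := by
  simp [Matrix.one_apply]

theorem lt_cases : ∀ {s t : Fin 3}, t < s →
    (s = 1 ∧ t = 0) ∨ (s = 2 ∧ t = 1) ∨ (s = 2 ∧ t = 0) := by
  decide

theorem Generic.fin_two {q x₀ x₁ : ℂ} (h : Generic q ![x₀, x₁]) :
    x₀ - x₁ ≠ 0 ∧ x₀ - q * x₁ ≠ 0 ∧ x₁ - q * x₀ ≠ 0 :=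
  ⟨sub_ne_zero.2 (h 0 1 (by decide)).1, sub_ne_zero.2 (h 0 1 (by decide)).2,
    sub_ne_zero.2 (h 1 0 (by decide)).2⟩

theorem Generic.fin_three {q x₀ x₁ x₂ : ℂ} (h : Generic q ![x₀, x₁, x₂]) :
    (x₀ - x₁ ≠ 0 ∧ x₀ - q * x₁ ≠ 0 ∧ x₁ - q * x₀ ≠ 0) ∧
    (x₀ - x₂ ≠ 0 ∧ x₀ - q * x₂ ≠ 0 ∧ x₂ - q * x₀ ≠ 0) ∧
    (x₁ - x₂ ≠ 0 ∧ x₁ - q * x₂ ≠ 0 ∧ x₂ - q * x₁ ≠ 0) :=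
  ⟨⟨sub_ne_zero.2 (h 0 1 (by decide)).1, sub_ne_zero.2 (h 0 1 (by decide)).2,
    sub_ne_zero.2 (h 1 0 (by decide)).2⟩,
  ⟨sub_ne_zero.2 (h 0 2 (by decide)).1, sub_ne_zero.2 (h 0 2 (by decide)).2,
    sub_ne_zero.2 (h 2 0 (by decide)).2⟩,
  ⟨sub_ne_zero.2 (h 1 2 (by decide)).1, sub_ne_zero.2 (h 1 2 (by decide)).2,
    sub_ne_zero.2 (h 2 1 (by decide)).2⟩⟩

/-- The denominators occurring at a site with parameter `x` do not vanish. -/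
def Regular (q z x : ℂ) : Prop := x - q ^ 2 * z ≠ 0 ∧ x - q ^ 3 * z ≠ 0

-- The limit z → ∞ of the exchange relation for (1,2): W(1,2;1,2) tends to 1/q² and W(2,1;1,2) to 0.
-- It is verified directly on at most three sites.
set_option linter.all false in
set_option maxHeartbeats 1600000 in
theorem limit_one_mul_two {q y : ℂ} (hq₀ : q ≠ 0) (hq₁ : q ≠ -1) {x : Fin N → ℂ}
    (hx : Generic q x) (hy : ∀ i, Regular q y (x i)) :
    colOp (limitData q) q x 1 * colOp (gammaData q y) q x 2 =
      (1 / q ^ 2) • (colOp (gammaData q y) q x 2 * colOp (limitData q) q x 1) := by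
  have hq : 1 + q ≠ 0 := fun h => hq₁ (by linear_combination h)
  have := exchange_of_active (L := limitData q) (L' := gammaData q y) hq₁ 1 2
    (fun i j => if i = 1 ∧ j = 2 then 1 / q ^ 2 else 0) ?_ (Regular q y) ?_ hx hy
  · simpa [Fin.sum_univ_three] using this
  · intro i j h
    simp only [ne_eq, ite_eq_right_iff, Classical.not_imp] at h
    rw [h.1.1, h.1.2]
  intro n x hn hx hy a b hm hab hsum
  simp only [ite_and, ite_mul, zero_mul, Finset.sum_ite_eq', Finset.mem_univ, if_true,
    Finset.sum_ite_irrel, Finset.sum_const_zero]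
  have hn' : n ≤ 3 := hn
  clear hn
  interval_cases n
  · exact absurd hsum (by simp)
  · obtain ⟨a₀, rfl⟩ := exists_vec_one a
    obtain ⟨b₀, rfl⟩ := exists_vec_one b
    rcases lt_cases (hab 0) with h | h | h <;>
    simp only [Matrix.cons_val_zero] at h <;>
    obtain ⟨rfl, rfl⟩ := h <;>
    exact absurd hsum (by decide)
  · obtain ⟨x₀, x₁, rfl⟩ := exists_vec_two x
    obtain ⟨a₀, a₁, rfl⟩ := exists_vec_two a
    obtain ⟨b₀, b₁, rfl⟩ := exists_vec_two b
    obtain ⟨p₀, r₀⟩ : Regular q y x₀ := hy 0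
    obtain ⟨p₁, r₁⟩ : Regular q y x₁ := hy 1
    obtain ⟨h₀₁, g₀₁, g₁₀⟩ := hx.fin_two
    -- These rewritings bring every difference occurring in a denominator to the orientation for
    -- which nonvanishing is known.
    have s₀₁ : x₁ - x₀ = -(x₀ - x₁) := by ring
    have t₀₁ : q * x₁ - x₀ = -(x₀ - q * x₁) := by ring
    have t₁₀ : q * x₀ - x₁ = -(x₁ - q * x₀) := by ring
    rcases lt_cases (hab 0) with h | h | h <;> rcases lt_cases (hab 1) with h' | h' | h' <;>
    simp only [Matrix.cons_val_zero, Matrix.cons_val_one] at h h' <;>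
    obtain ⟨rfl, rfl⟩ := h <;> obtain ⟨rfl, rfl⟩ := h' <;>
    first
    | exact absurd hsum (by decide)
    | exact absurd (hm (show (0 : Fin 3) ≤ 1 by decide)) (by decide)
    | exact absurd (hm (show (1 : Fin 3) ≤ 2 by decide)) (by decide)
    | simp only [colOp_one_mul_fin_two, colOp_two_mul_fin_two, one_apply_two, sub_self,
        Fin.reduceEq, Fin.reduceSub, if_true, if_false, true_and, and_true, false_and, and_false,
        mul_zero, zero_mul, add_zero, zero_add, Fin.isValue]
      simp only [limitData, gammaData, dress, dressBoth, pairWeight, Matrix.cons_val,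
        Pi.one_apply, mul_one, one_mul, mul_zero, zero_mul, add_zero, zero_add, s₀₁, t₀₁, t₁₀]
      field_simp
      ring
  · obtain ⟨x₀, x₁, x₂, rfl⟩ := exists_vec_three x
    obtain ⟨a₀, a₁, a₂, rfl⟩ := exists_vec_three a
    obtain ⟨b₀, b₁, b₂, rfl⟩ := exists_vec_three b
    obtain ⟨p₀, r₀⟩ : Regular q y x₀ := hy 0
    obtain ⟨p₁, r₁⟩ : Regular q y x₁ := hy 1
    obtain ⟨p₂, r₂⟩ : Regular q y x₂ := hy 2
    obtain ⟨⟨h₀₁, g₀₁, g₁₀⟩, ⟨h₀₂, g₀₂, g₂₀⟩, ⟨h₁₂, g₁₂, g₂₁⟩⟩ := hx.fin_three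
    have s₀₁ : x₁ - x₀ = -(x₀ - x₁) := by ring
    have s₀₂ : x₂ - x₀ = -(x₀ - x₂) := by ring
    have s₁₂ : x₂ - x₁ = -(x₁ - x₂) := by ring
    have t₀₁ : q * x₁ - x₀ = -(x₀ - q * x₁) := by ring
    have t₁₀ : q * x₀ - x₁ = -(x₁ - q * x₀) := by ring
    have t₀₂ : q * x₂ - x₀ = -(x₀ - q * x₂) := by ring
    have t₂₀ : q * x₀ - x₂ = -(x₂ - q * x₀) := by ring
    have t₁₂ : q * x₂ - x₁ = -(x₁ - q * x₂) := by ring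
    have t₂₁ : q * x₁ - x₂ = -(x₂ - q * x₁) := by ring
    rcases lt_cases (hab 0) with h | h | h <;> rcases lt_cases (hab 1) with h' | h' | h' <;>
    rcases lt_cases (hab 2) with h'' | h'' | h'' <;>
    simp only [Matrix.cons_val] at h h' h'' <;>
    obtain ⟨rfl, rfl⟩ := h <;> obtain ⟨rfl, rfl⟩ := h' <;> obtain ⟨rfl, rfl⟩ := h'' <;>
    first
    | exact absurd hsum (by decide)
    | exact absurd (hm (show (0 : Fin 3) ≤ 1 by decide)) (by decide)
    | exact absurd (hm (show (1 : Fin 3) ≤ 2 by decide)) (by decide)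
    | simp only [colOp_one_mul_fin_three, colOp_two_mul_fin_three, one_apply_three, sub_self,
        Fin.reduceEq, Fin.reduceSub, if_true, if_false, true_and, and_true, false_and, and_false,
        mul_zero, zero_mul, add_zero, zero_add, Fin.isValue]
      simp only [limitData, gammaData, dress, dressBoth, pairWeight, Matrix.cons_val,
        Pi.one_apply, mul_one, one_mul, mul_zero, zero_mul, add_zero, zero_add,
        s₀₁, t₀₁, t₁₀, s₀₂, t₀₂, t₂₀, s₁₂, t₁₂, t₂₁]
      field_simp
      ring

theorem W_eq_zero (q x y : ℂ) {i j k l : Fin 3} (h : (i : ℕ) + j ≠ k + l) :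
    W q x y i j k l = 0 := by
  revert h
  fin_cases i <;> fin_cases j <;> fin_cases k <;> fin_cases l <;>
    first | (intro h; rfl) | (intro h; exact absurd rfl h)

-- The coefficients 1 and 1 - 1/q² are the limits of W(1,0;1,0) and W(0,1;1,0) as z → ∞.
set_option linter.all false in
theorem limit_one_mul_zero {q y : ℂ} (hq₀ : q ≠ 0) (hq₁ : q ≠ -1) {x : Fin N → ℂ}
    (hx : Generic q x) (hy : ∀ i, Regular q y (x i)) :
    colOp (limitData q) q x 1 * colOp (gammaData q y) q x 0 =
      colOp (gammaData q y) q x 0 * colOp (limitData q) q x 1 +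
      (1 - 1 / q ^ 2) • (colOp (gammaData q y) q x 1 * colOp (limitData q) q x 0) := by
  have := exchange_of_active (L := limitData q) (L' := gammaData q y) hq₁ 1 0
    (fun i j => if i = 1 ∧ j = 0 then 1 else if i = 0 ∧ j = 1 then 1 - 1 / q ^ 2 else 0)
    ?_ (Regular q y) ?_ hx hy
  · simpa [Fin.sum_univ_three, add_comm] using this
  · intro i j h
    fin_cases i <;> fin_cases j <;> simp at h ⊢
  intro n x hn hx hy a b hm hab hsum
  simp only [Fin.sum_univ_three, Fin.reduceEq, if_true, if_false, true_and, and_true, false_and,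
    and_false, zero_mul, add_zero, zero_add, Fin.isValue]
  have hn' : n ≤ 1 := hn
  clear hn
  interval_cases n
  · exact absurd hsum (by simp)
  · obtain ⟨x₀, rfl⟩ := exists_vec_one x
    obtain ⟨a₀, rfl⟩ := exists_vec_one a
    obtain ⟨b₀, rfl⟩ := exists_vec_one b
    obtain ⟨p₀, r₀⟩ : Regular q y x₀ := hy 0
    rcases lt_cases (hab 0) with h | h | h <;>
    simp only [Matrix.cons_val_zero] at h <;>
    obtain ⟨rfl, rfl⟩ := h <;>
    first
    | exact absurd hsum (by decide)
    | simp only [colOp_zero_mul_fin_one, colOp_one_mul_fin_one, one_apply_one, sub_self,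
        Fin.reduceEq, Fin.reduceSub, if_true, if_false, Fin.isValue]
      simp only [limitData, gammaData, Matrix.cons_val, mul_one, one_mul]
      field_simp
      ring

-- The coefficients are the limits of W(1,1;1,1) and W(0,2;1,1) as z → ∞; W(2,0;1,1) tends to 0.
set_option linter.all false in
theorem limit_one_mul_one {q y : ℂ} (hq₀ : q ≠ 0) (hq₁ : q ≠ -1) {x : Fin N → ℂ}
    (hx : Generic q x) (hy : ∀ i, Regular q y (x i)) :
    colOp (limitData q) q x 1 * colOp (gammaData q y) q x 1 =
      (-(1 / q)) • (colOp (gammaData q y) q x 1 * colOp (limitData q) q x 1) +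
      (-((1 - q) ^ 2 * (1 + q) / q ^ 4)) •
        (colOp (gammaData q y) q x 2 * colOp (limitData q) q x 0) := by
  have hq : 1 + q ≠ 0 := fun h => hq₁ (by linear_combination h)
  have := exchange_of_active (L := limitData q) (L' := gammaData q y) hq₁ 1 1
    (fun i j => if i = 1 ∧ j = 1 then -(1 / q) else if i = 0 ∧ j = 2 then
      -((1 - q) ^ 2 * (1 + q) / q ^ 4) else 0) ?_ (Regular q y) ?_ hx hy
  · simpa [Fin.sum_univ_three, add_comm] using this
  · intro i j h
    fin_cases i <;> fin_cases j <;> simp at h ⊢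
  intro n x hn hx hy a b hm hab hsum
  simp only [Fin.sum_univ_three, Fin.reduceEq, if_true, if_false, true_and, and_true, false_and,
    and_false, zero_mul, add_zero, zero_add, Fin.isValue]
  have hn' : n ≤ 2 := hn
  clear hn
  interval_cases n
  · exact absurd hsum (by simp)
  · obtain ⟨x₀, rfl⟩ := exists_vec_one x
    obtain ⟨a₀, rfl⟩ := exists_vec_one a
    obtain ⟨b₀, rfl⟩ := exists_vec_one b
    obtain ⟨p₀, r₀⟩ : Regular q y x₀ := hy 0
    rcases lt_cases (hab 0) with h | h | h <;>
    simp only [Matrix.cons_val_zero] at h <;>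
    obtain ⟨rfl, rfl⟩ := h <;>
    first
    | exact absurd hsum (by decide)
    | simp only [colOp_zero_mul_fin_one, colOp_one_mul_fin_one, colOp_two_mul_fin_one,
        one_apply_one, sub_self, Fin.reduceEq, Fin.reduceSub, if_true, if_false, Fin.isValue]
      simp only [limitData, gammaData, Matrix.cons_val, mul_one, one_mul]
      field_simp
      ring
  · obtain ⟨x₀, x₁, rfl⟩ := exists_vec_two x
    obtain ⟨a₀, a₁, rfl⟩ := exists_vec_two a
    obtain ⟨b₀, b₁, rfl⟩ := exists_vec_two b
    obtain ⟨p₀, r₀⟩ : Regular q y x₀ := hy 0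
    obtain ⟨p₁, r₁⟩ : Regular q y x₁ := hy 1
    obtain ⟨h₀₁, g₀₁, g₁₀⟩ := hx.fin_two
    have s₀₁ : x₁ - x₀ = -(x₀ - x₁) := by ring
    have t₀₁ : q * x₁ - x₀ = -(x₀ - q * x₁) := by ring
    have t₁₀ : q * x₀ - x₁ = -(x₁ - q * x₀) := by ring
    rcases lt_cases (hab 0) with h | h | h <;> rcases lt_cases (hab 1) with h' | h' | h' <;>
    simp only [Matrix.cons_val_zero, Matrix.cons_val_one] at h h' <;>
    obtain ⟨rfl, rfl⟩ := h <;> obtain ⟨rfl, rfl⟩ := h' <;>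
    first
    | exact absurd hsum (by decide)
    | exact absurd (hm (show (0 : Fin 2) ≤ 1 by decide)) (by decide)
    | simp only [colOp_zero_mul_fin_two, colOp_one_mul_fin_two, colOp_two_mul_fin_two,
        one_apply_two, sub_self, Fin.reduceEq, Fin.reduceSub, if_true, if_false, true_and,
        and_true, false_and, and_false, mul_zero, zero_mul, add_zero, zero_add, Fin.isValue]
      simp only [limitData, gammaData, dress, dressBoth, pairWeight, Matrix.cons_val,
        Pi.one_apply, mul_one, one_mul, mul_zero, zero_mul, add_zero, zero_add, s₀₁, t₀₁, t₁₀]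
      field_simp
      ring

/-- The limit of Γ_0 is diagonal with eigenvalue (1/q²)^(total state), and the operator with index
`k` lowers the total by `k`. -/
theorem limit_zero_mul (q : ℂ) (L : ColumnData) (x : Fin N → ℂ) (k : Fin 3) :
    colOp (limitData q) q x 0 * colOp L q x k =
      (1 / q ^ 2) ^ (k : ℕ) • (colOp L q x k * colOp (limitData q) q x 0) := by
  have hK : colOp (limitData q) q x 0 =
      Matrix.diagonal fun a => (1 / q ^ 2) ^ ∑ i, (a i : ℕ) := by
    ext a c
    rw [Matrix.diagonal_apply]
    simp only [colOp, Matrix.of_apply, eq_comm (a := c), ← Finset.prod_pow_eq_pow_sum]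
    refine if_congr Iff.rfl (prod_congr rfl fun i _ => ?_) rfl
    generalize a i = s
    fin_cases s <;> simp [limitData, ← pow_mul]
  rw [hK]
  ext a c
  simp only [Matrix.diagonal_mul, Matrix.smul_apply, Matrix.mul_diagonal, smul_eq_mul]
  by_cases h : colOp L q x k a c = 0
  · simp [h]
  · rw [(le_and_sum_eq_of_colOp_ne_zero h).2, pow_add]
    ring

theorem isUnit_limit_zero {q : ℂ} (hq₀ : q ≠ 0) (x : Fin N → ℂ) :
    IsUnit (colOp (limitData q) q x 0) := by
  have hK : colOp (limitData q) q x 0 =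
      Matrix.diagonal fun a => ∏ i, (limitData q).diag (a i) (x i) := by
    ext a c
    simp only [colOp, Matrix.of_apply, Matrix.diagonal_apply, eq_comm (a := c)]
  rw [hK, Matrix.isUnit_diagonal, Pi.isUnit_iff]
  intro a
  rw [isUnit_iff_ne_zero, Finset.prod_ne_zero_iff]
  intro i _
  generalize a i = s
  fin_cases s <;> simp [limitData, hq₀]

theorem colOp_zero_mul_colOp_zero (L L' : ColumnData) (q : ℂ) (x : Fin N → ℂ) :
    colOp L q x 0 * colOp L' q x 0 = colOp L' q x 0 * colOp L q x 0 := by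
  ext a b
  rw [colOp_zero_mul, colOp_zero_mul]
  simp only [colOp, Matrix.of_apply]
  split_ifs with h
  · exact mul_comm _ _
  · simp

/-! ### Exchange relations verified directly: (1,0), (0,1) and (0,2) -/

set_option linter.all false in
theorem exchange_of_add_eq_one {q y z : ℂ} (hq₀ : q ≠ 0) (hq₁ : q ≠ -1) (hyz : Regular q z y)
    {x : Fin N → ℂ} (hx : Generic q x) (hz : ∀ i, Regular q z (x i))
    (hy : ∀ i, Regular q y (x i)) {k l : Fin 3}
    (hkl : (k = 1 ∧ l = 0) ∨ (k = 0 ∧ l = 1)) :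
    colOp (gammaData q z) q x k * colOp (gammaData q y) q x l =
      ∑ i, ∑ j, W q y z i j k l •
        (colOp (gammaData q y) q x j * colOp (gammaData q z) q x i) := by
  obtain ⟨w₁, w₂⟩ := hyz
  refine exchange_of_active hq₁ k l _ (fun i j h => by_contra fun h' => h (W_eq_zero q y z h'))
    (fun x => Regular q z x ∧ Regular q y x) ?_ hx fun i => ⟨hz i, hy i⟩
  intro n x hn hx hy a b hm hab hsum
  have hn' : n ≤ 1 := by rcases hkl with ⟨rfl, rfl⟩ | ⟨rfl, rfl⟩ <;> exact hn
  clear hn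
  interval_cases n
  · rcases hkl with ⟨rfl, rfl⟩ | ⟨rfl, rfl⟩ <;> exact absurd hsum (by simp)
  · obtain ⟨x₀, rfl⟩ := exists_vec_one x
    obtain ⟨a₀, rfl⟩ := exists_vec_one a
    obtain ⟨b₀, rfl⟩ := exists_vec_one b
    obtain ⟨⟨p₀, r₀⟩, ⟨p₀', r₀'⟩⟩ : Regular q z x₀ ∧ Regular q y x₀ := hy 0
    rcases hkl with ⟨rfl, rfl⟩ | ⟨rfl, rfl⟩ <;>
    rcases lt_cases (hab 0) with h | h | h <;>
    simp only [Matrix.cons_val_zero] at h <;>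
    obtain ⟨rfl, rfl⟩ := h <;>
    first
    | exact absurd hsum (by decide)
    | simp only [Fin.sum_univ_three, W, colOp_zero_mul_fin_one, colOp_one_mul_fin_one,
        colOp_two_mul_fin_one, one_apply_one, sub_self, Fin.reduceEq, Fin.reduceSub, if_true,
        if_false, zero_mul, mul_zero, add_zero, zero_add, Fin.isValue]
      simp only [gammaData, Matrix.cons_val, mul_one, one_mul]
      apply mul_left_cancel₀ hq₀
      field_simp
      ring

-- With the degree-one relations this is the only seed needed: left multiplication by `F` then
-- determines everything else.
set_option linter.all false in
set_option maxHeartbeats 3200000 in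
theorem exchange_zero_two {q y z : ℂ} (hq₀ : q ≠ 0) (hq₁ : q ≠ -1) (hyz : Regular q z y)
    {x : Fin N → ℂ} (hx : Generic q x) (hz : ∀ i, Regular q z (x i))
    (hy : ∀ i, Regular q y (x i)) :
    colOp (gammaData q z) q x 0 * colOp (gammaData q y) q x 2 =
      ∑ i, ∑ j, W q y z i j 0 2 •
        (colOp (gammaData q y) q x j * colOp (gammaData q z) q x i) := by
  obtain ⟨w₁, w₂⟩ := hyz
  have hq : 1 + q ≠ 0 := fun h => hq₁ (by linear_combination h)
  refine exchange_of_active hq₁ 0 2 _ (fun i j h => by_contra fun h' => h (W_eq_zero q y z h'))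
    (fun x => Regular q z x ∧ Regular q y x) ?_ hx fun i => ⟨hz i, hy i⟩
  intro n x hn hx hy a b hm hab hsum
  have hn' : n ≤ 2 := hn
  clear hn
  interval_cases n
  · exact absurd hsum (by simp)
  · obtain ⟨x₀, rfl⟩ := exists_vec_one x
    obtain ⟨a₀, rfl⟩ := exists_vec_one a
    obtain ⟨b₀, rfl⟩ := exists_vec_one b
    obtain ⟨⟨p₀, r₀⟩, ⟨p₀', r₀'⟩⟩ : Regular q z x₀ ∧ Regular q y x₀ := hy 0
    rcases lt_cases (hab 0) with h | h | h <;>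
    simp only [Matrix.cons_val_zero] at h <;>
    obtain ⟨rfl, rfl⟩ := h <;>
    first
    | exact absurd hsum (by decide)
    | simp only [Fin.sum_univ_three, W, colOp_zero_mul_fin_one, colOp_one_mul_fin_one,
        colOp_two_mul_fin_one, one_apply_one, sub_self, Fin.reduceEq, Fin.reduceSub, if_true,
        if_false, zero_mul, mul_zero, add_zero, zero_add, Fin.isValue]
      simp only [gammaData, Matrix.cons_val, mul_one, one_mul]
      apply mul_left_cancel₀ hq₀
      field_simp
      ring
  · obtain ⟨x₀, x₁, rfl⟩ := exists_vec_two x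
    obtain ⟨a₀, a₁, rfl⟩ := exists_vec_two a
    obtain ⟨b₀, b₁, rfl⟩ := exists_vec_two b
    obtain ⟨⟨p₀, r₀⟩, ⟨p₀', r₀'⟩⟩ : Regular q z x₀ ∧ Regular q y x₀ := hy 0
    obtain ⟨⟨p₁, r₁⟩, ⟨p₁', r₁'⟩⟩ : Regular q z x₁ ∧ Regular q y x₁ := hy 1
    obtain ⟨h₀₁, g₀₁, g₁₀⟩ := hx.fin_two
    have s₀₁ : x₁ - x₀ = -(x₀ - x₁) := by ring
    have t₀₁ : q * x₁ - x₀ = -(x₀ - q * x₁) := by ring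
    have t₁₀ : q * x₀ - x₁ = -(x₁ - q * x₀) := by ring
    rcases lt_cases (hab 0) with h | h | h <;> rcases lt_cases (hab 1) with h' | h' | h' <;>
    simp only [Matrix.cons_val_zero, Matrix.cons_val_one] at h h' <;>
    obtain ⟨rfl, rfl⟩ := h <;> obtain ⟨rfl, rfl⟩ := h' <;>
    first
    | exact absurd hsum (by decide)
    | exact absurd (hm (show (0 : Fin 2) ≤ 1 by decide)) (by decide)
    | simp only [Fin.sum_univ_three, W, colOp_zero_mul_fin_two, colOp_one_mul_fin_two,
        colOp_two_mul_fin_two, one_apply_two, sub_self, Fin.reduceEq, Fin.reduceSub, if_true,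
        if_false, true_and, and_true, false_and, and_false, mul_zero, zero_mul, add_zero, zero_add,
        Fin.isValue]
      simp only [gammaData, dress, dressBoth, pairWeight, Matrix.cons_val,
        Pi.one_apply, mul_one, one_mul, mul_zero, zero_mul, add_zero, zero_add, s₀₁, t₀₁, t₁₀]
      apply mul_left_cancel₀ hq₀
      field_simp
      ring

/-! ### Deriving the remaining relations by multiplication with the raising element -/

section Raising

variable {R : Type*} [Ring R] [Algebra ℂ R]

/-- The relations of a family `A₀, A₁, A₂` with a raising element `F` and a grading element `K`. -/
structure IsRaising (s c₀ c₁ c₂ : ℂ) (F K : R) (A : Fin 3 → R) : Prop where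
  zero : F * A 0 = A 0 * F + c₀ • (A 1 * K)
  one : F * A 1 = c₁ • (A 1 * F) + c₂ • (A 2 * K)
  two : F * A 2 = s • (A 2 * F)
  grade_zero : K * A 0 = A 0 * K
  grade_one : K * A 1 = s • (A 1 * K)
  grade_two : K * A 2 = s ^ 2 • (A 2 * K)

variable {s c₀ c₁ c₂ : ℂ} {F K : R} {A B : Fin 3 → R}

theorem IsRaising.mul_zero_one (hA : IsRaising s c₀ c₁ c₂ F K A)
    (hB : IsRaising s c₀ c₁ c₂ F K B) :
    F * (A 0 * B 1) = c₁ • (A 0 * B 1 * F) + c₂ • (A 0 * B 2 * K) +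
      (c₀ * s) • (A 1 * B 1 * K) := by
  rw [← mul_assoc, hA.zero, add_mul, mul_assoc, hB.one, smul_mul_assoc, mul_assoc (A 1),
    hB.grade_one, mul_add]
  simp only [mul_smul_comm, smul_smul, mul_assoc]

theorem IsRaising.mul_one_zero (hA : IsRaising s c₀ c₁ c₂ F K A)
    (hB : IsRaising s c₀ c₁ c₂ F K B) :
    F * (A 1 * B 0) = c₁ • (A 1 * B 0 * F) + (c₁ * c₀) • (A 1 * B 1 * K) +
      c₂ • (A 2 * B 0 * K) := by
  rw [← mul_assoc, hA.one, add_mul, smul_mul_assoc, mul_assoc, hB.zero, smul_mul_assoc,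
    mul_assoc (A 2), hB.grade_zero, mul_add, smul_add]
  simp only [mul_smul_comm, smul_smul, mul_assoc]

theorem IsRaising.mul_zero_two (hA : IsRaising s c₀ c₁ c₂ F K A)
    (hB : IsRaising s c₀ c₁ c₂ F K B) :
    F * (A 0 * B 2) = s • (A 0 * B 2 * F) + (c₀ * s ^ 2) • (A 1 * B 2 * K) := by
  rw [← mul_assoc, hA.zero, add_mul, mul_assoc, hB.two, smul_mul_assoc, mul_assoc (A 1),
    hB.grade_two]
  simp only [mul_smul_comm, smul_smul, mul_assoc]

theorem IsRaising.mul_two_zero (hA : IsRaising s c₀ c₁ c₂ F K A)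
    (hB : IsRaising s c₀ c₁ c₂ F K B) :
    F * (A 2 * B 0) = s • (A 2 * B 0 * F) + (s * c₀) • (A 2 * B 1 * K) := by
  rw [← mul_assoc, hA.two, smul_mul_assoc, mul_assoc, hB.zero, mul_add, smul_add]
  simp only [mul_smul_comm, smul_smul, mul_assoc]

theorem IsRaising.mul_one_one (hA : IsRaising s c₀ c₁ c₂ F K A)
    (hB : IsRaising s c₀ c₁ c₂ F K B) :
    F * (A 1 * B 1) = (c₁ * c₁) • (A 1 * B 1 * F) + (c₁ * c₂) • (A 1 * B 2 * K) +
      (c₂ * s) • (A 2 * B 1 * K) := by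
  rw [← mul_assoc, hA.one, add_mul, smul_mul_assoc, mul_assoc, hB.one, smul_mul_assoc,
    mul_assoc (A 2), hB.grade_one, mul_add, smul_add]
  simp only [mul_smul_comm, smul_smul, mul_assoc]

theorem IsRaising.mul_one_two (hA : IsRaising s c₀ c₁ c₂ F K A)
    (hB : IsRaising s c₀ c₁ c₂ F K B) :
    F * (A 1 * B 2) = (c₁ * s) • (A 1 * B 2 * F) + (c₂ * s ^ 2) • (A 2 * B 2 * K) := by
  rw [← mul_assoc, hA.one, add_mul, smul_mul_assoc, mul_assoc, hB.two, smul_mul_assoc,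
    mul_assoc (A 2), hB.grade_two]
  simp only [mul_smul_comm, smul_smul, mul_assoc]

theorem IsRaising.mul_two_one (hA : IsRaising s c₀ c₁ c₂ F K A)
    (hB : IsRaising s c₀ c₁ c₂ F K B) :
    F * (A 2 * B 1) = (c₁ * s) • (A 2 * B 1 * F) + (s * c₂) • (A 2 * B 2 * K) := by
  rw [← mul_assoc, hA.two, smul_mul_assoc, mul_assoc, hB.one, mul_add, smul_add]
  simp only [mul_smul_comm, smul_smul, mul_assoc, mul_comm s c₁]

theorem smul_mul_right_cancel {c : ℂ} (hc : c ≠ 0) (hK : IsUnit K) {X Y : R}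
    (h : c • (X * K) = c • (Y * K)) : X = Y :=
  hK.mul_left_injective (smul_right_injective R hc h)

/-- Expand `F * h` and subtract `c₁` times `h * F`: the terms ending in `F` cancel. Subtracting `c₂`
times `h' * K` removes `A 0 * B 2 * K`, leaving `A 1 * B 1 * K` with the factor `c₀ * s`. The
hypotheses on the `v`'s match coefficients. -/
theorem IsRaising.exchange_one_one (hA : IsRaising s c₀ c₁ c₂ F K A)
    (hB : IsRaising s c₀ c₁ c₂ F K B) (hK : IsUnit K) (hs : s ≠ 0) (hc₀ : c₀ ≠ 0)
    {u₁₀ u₀₁ w₂₀ w₁₁ w₀₂ v₂₀ v₁₁ v₀₂ : ℂ}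
    (h : A 0 * B 1 = u₁₀ • (B 0 * A 1) + u₀₁ • (B 1 * A 0))
    (h' : A 0 * B 2 = w₂₀ • (B 0 * A 2) + w₁₁ • (B 1 * A 1) + w₀₂ • (B 2 * A 0))
    (h₂₀ : c₀ * s * v₂₀ = u₁₀ * c₂ - c₂ * w₂₀)
    (h₁₁ : c₀ * s * v₁₁ = u₁₀ * (c₀ * s) + u₀₁ * (c₁ * c₀) - c₂ * w₁₁)
    (h₀₂ : c₀ * s * v₀₂ = u₀₁ * c₂ - c₂ * w₀₂) :
    A 1 * B 1 = v₂₀ • (B 0 * A 2) + v₁₁ • (B 1 * A 1) + v₀₂ • (B 2 * A 0) := by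
  have hF := congrArg (F * ·) h
  have hF' := congrArg (· * F) h
  have hK' := congrArg (· * K) h'
  simp only [mul_add, mul_smul_comm, hA.mul_zero_one hB, hB.mul_zero_one hA, hB.mul_one_zero hA,
    add_mul, smul_mul_assoc] at hF hF' hK'
  refine smul_mul_right_cancel (mul_ne_zero hc₀ hs) hK ?_
  rw [add_mul, add_mul, smul_mul_assoc, smul_mul_assoc, smul_mul_assoc, smul_add, smul_add,
    smul_smul, smul_smul, smul_smul, h₂₀, h₁₁, h₀₂]
  linear_combination (norm := module) hF - c₁ • hF' - c₂ • hK'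

theorem IsRaising.exchange_two_zero (hA : IsRaising s c₀ c₁ c₂ F K A)
    (hB : IsRaising s c₀ c₁ c₂ F K B) (hK : IsUnit K) (hc₂ : c₂ ≠ 0)
    {u₁₀ u₀₁ w₂₀ w₁₁ w₀₂ v₂₀ v₁₁ v₀₂ : ℂ}
    (h : A 1 * B 0 = u₁₀ • (B 0 * A 1) + u₀₁ • (B 1 * A 0))
    (h' : A 1 * B 1 = w₂₀ • (B 0 * A 2) + w₁₁ • (B 1 * A 1) + w₀₂ • (B 2 * A 0))
    (h₂₀ : c₂ * v₂₀ = u₁₀ * c₂ - c₁ * c₀ * w₂₀)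
    (h₁₁ : c₂ * v₁₁ = u₁₀ * (c₀ * s) + u₀₁ * (c₁ * c₀) - c₁ * c₀ * w₁₁)
    (h₀₂ : c₂ * v₀₂ = u₀₁ * c₂ - c₁ * c₀ * w₀₂) :
    A 2 * B 0 = v₂₀ • (B 0 * A 2) + v₁₁ • (B 1 * A 1) + v₀₂ • (B 2 * A 0) := by
  have hF := congrArg (F * ·) h
  have hF' := congrArg (· * F) h
  have hK' := congrArg (· * K) h'
  simp only [mul_add, mul_smul_comm, hA.mul_one_zero hB, hB.mul_zero_one hA, hB.mul_one_zero hA,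
    add_mul, smul_mul_assoc] at hF hF' hK'
  refine smul_mul_right_cancel hc₂ hK ?_
  rw [add_mul, add_mul, smul_mul_assoc, smul_mul_assoc, smul_mul_assoc, smul_add, smul_add,
    smul_smul, smul_smul, smul_smul, h₂₀, h₁₁, h₀₂]
  linear_combination (norm := module) hF - c₁ • hF' - (c₁ * c₀) • hK'

/-- Moving `F` past `B 1 * A 1` costs `c₁ * c₁`, past the other products `s`; since these agree,
subtracting `s` times `h * F` removes all terms ending in `F`. -/
theorem IsRaising.exchange_two_one (hA : IsRaising s c₀ c₁ c₂ F K A)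
    (hB : IsRaising s c₀ c₁ c₂ F K B) (hK : IsUnit K) (hs : s ≠ 0) (hc₀ : c₀ ≠ 0)
    (hc₁ : c₁ * c₁ = s) {w₂₀ w₁₁ w₀₂ v₂₁ v₁₂ : ℂ}
    (h : A 2 * B 0 = w₂₀ • (B 0 * A 2) + w₁₁ • (B 1 * A 1) + w₀₂ • (B 2 * A 0))
    (h₂₁ : s * c₀ * v₂₁ = w₂₀ * (c₀ * s ^ 2) + w₁₁ * (c₁ * c₂))
    (h₁₂ : s * c₀ * v₁₂ = w₁₁ * (c₂ * s) + w₀₂ * (s * c₀)) :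
    A 2 * B 1 = v₂₁ • (B 1 * A 2) + v₁₂ • (B 2 * A 1) := by
  have hF := congrArg (F * ·) h
  have hF' := congrArg (· * F) h
  simp only [mul_add, mul_smul_comm, hA.mul_two_zero hB, hB.mul_zero_two hA, hB.mul_one_one hA,
    hB.mul_two_zero hA, hc₁, add_mul, smul_mul_assoc] at hF hF'
  refine smul_mul_right_cancel (mul_ne_zero hs hc₀) hK ?_
  rw [add_mul, smul_mul_assoc, smul_mul_assoc, smul_add, smul_smul, smul_smul, h₂₁, h₁₂]
  linear_combination (norm := module) hF - s • hF'

theorem IsRaising.exchange_one_two (hA : IsRaising s c₀ c₁ c₂ F K A)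
    (hB : IsRaising s c₀ c₁ c₂ F K B) (hK : IsUnit K) (hs : s ≠ 0) (hc₀ : c₀ ≠ 0)
    (hc₁ : c₁ * c₁ = s) {w₂₀ w₁₁ w₀₂ v₂₁ v₁₂ : ℂ}
    (h : A 0 * B 2 = w₂₀ • (B 0 * A 2) + w₁₁ • (B 1 * A 1) + w₀₂ • (B 2 * A 0))
    (h₂₁ : c₀ * s ^ 2 * v₂₁ = w₂₀ * (c₀ * s ^ 2) + w₁₁ * (c₁ * c₂))
    (h₁₂ : c₀ * s ^ 2 * v₁₂ = w₁₁ * (c₂ * s) + w₀₂ * (s * c₀)) :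
    A 1 * B 2 = v₂₁ • (B 1 * A 2) + v₁₂ • (B 2 * A 1) := by
  have hF := congrArg (F * ·) h
  have hF' := congrArg (· * F) h
  simp only [mul_add, mul_smul_comm, hA.mul_zero_two hB, hB.mul_zero_two hA, hB.mul_one_one hA,
    hB.mul_two_zero hA, hc₁, add_mul, smul_mul_assoc] at hF hF'
  refine smul_mul_right_cancel (mul_ne_zero hc₀ (pow_ne_zero 2 hs)) hK ?_
  rw [add_mul, smul_mul_assoc, smul_mul_assoc, smul_add, smul_smul, smul_smul, h₂₁, h₁₂]
  linear_combination (norm := module) hF - s • hF'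

/-- On the right both products raise to multiples of `B 2 * A 2 * K`, and `hv` says that these add
up to the coefficient on the left. -/
theorem IsRaising.exchange_two_two (hA : IsRaising s c₀ c₁ c₂ F K A)
    (hB : IsRaising s c₀ c₁ c₂ F K B) (hK : IsUnit K) (hs : s ≠ 0) (hc₂ : c₂ ≠ 0)
    {v₂₁ v₁₂ : ℂ} (h : A 2 * B 1 = v₂₁ • (B 1 * A 2) + v₁₂ • (B 2 * A 1))
    (hv : v₂₁ * s + v₁₂ = 1) :
    A 2 * B 2 = B 2 * A 2 := by
  have hF := congrArg (F * ·) h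
  have hF' := congrArg (· * F) h
  simp only [mul_add, mul_smul_comm, hA.mul_two_one hB, hB.mul_one_two hA, hB.mul_two_one hA,
    add_mul, smul_mul_assoc] at hF hF'
  refine smul_mul_right_cancel (mul_ne_zero hs hc₂) hK ?_
  have hv' : v₁₂ = 1 - v₂₁ * s := by linear_combination hv
  subst hv'
  linear_combination (norm := module) hF - (c₁ * s) • hF'

end Raising

/-! ### Conservation in the vertex weights and assembly of all exchange relations -/

section Weights

variable {R : Type*} [AddCommGroup R] [Module ℂ R] {k l : Fin 3}

theorem sum_W_of_add_eq_one (q x y : ℂ) (h : (k : ℕ) + l = 1) (M : Fin 3 → Fin 3 → R) :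
    ∑ i, ∑ j, W q x y i j k l • M i j = W q x y 1 0 k l • M 1 0 + W q x y 0 1 k l • M 0 1 := by
  have h' : ∀ i j : Fin 3, (i : ℕ) + j ≠ 1 → W q x y i j k l = 0 := fun i j hij =>
    W_eq_zero q x y (by rwa [h])
  simp only [Fin.sum_univ_three, h' 0 0 (by decide), h' 0 2 (by decide), h' 1 1 (by decide),
    h' 1 2 (by decide), h' 2 0 (by decide), h' 2 1 (by decide), h' 2 2 (by decide), zero_smul,
    add_zero, zero_add]
  abel

theorem sum_W_of_add_eq_two (q x y : ℂ) (h : (k : ℕ) + l = 2) (M : Fin 3 → Fin 3 → R) :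
    ∑ i, ∑ j, W q x y i j k l • M i j =
      W q x y 2 0 k l • M 2 0 + W q x y 1 1 k l • M 1 1 + W q x y 0 2 k l • M 0 2 := by
  have h' : ∀ i j : Fin 3, (i : ℕ) + j ≠ 2 → W q x y i j k l = 0 := fun i j hij =>
    W_eq_zero q x y (by rwa [h])
  simp only [Fin.sum_univ_three, h' 0 0 (by decide), h' 0 1 (by decide), h' 1 0 (by decide),
    h' 1 2 (by decide), h' 2 1 (by decide), h' 2 2 (by decide), zero_smul, add_zero, zero_add]
  abel

theorem sum_W_of_add_eq_three (q x y : ℂ) (h : (k : ℕ) + l = 3) (M : Fin 3 → Fin 3 → R) :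
    ∑ i, ∑ j, W q x y i j k l • M i j = W q x y 2 1 k l • M 2 1 + W q x y 1 2 k l • M 1 2 := by
  have h' : ∀ i j : Fin 3, (i : ℕ) + j ≠ 3 → W q x y i j k l = 0 := fun i j hij =>
    W_eq_zero q x y (by rwa [h])
  simp only [Fin.sum_univ_three, h' 0 0 (by decide), h' 0 1 (by decide), h' 1 0 (by decide),
    h' 0 2 (by decide), h' 1 1 (by decide), h' 2 0 (by decide), h' 2 2 (by decide), zero_smul,
    add_zero, zero_add]
  abel

theorem sum_W_two_two (q x y : ℂ) (M : Fin 3 → Fin 3 → R) :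
    ∑ i, ∑ j, W q x y i j 2 2 • M i j = M 2 2 := by
  have h' : ∀ i j : Fin 3, (i : ℕ) + j ≠ 4 → W q x y i j 2 2 = 0 := fun i j hij =>
    W_eq_zero q x y hij
  simp only [Fin.sum_univ_three, h' 0 0 (by decide), h' 0 1 (by decide), h' 1 0 (by decide),
    h' 0 2 (by decide), h' 1 1 (by decide), h' 2 0 (by decide), h' 1 2 (by decide),
    h' 2 1 (by decide), zero_smul, add_zero, zero_add]
  exact one_smul ℂ _

end Weights

theorem isRaising_gammaData {q y : ℂ} (hq₀ : q ≠ 0) (hq₁ : q ≠ -1) {x : Fin N → ℂ}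
    (hx : Generic q x) (hy : ∀ i, Regular q y (x i)) :
    IsRaising (1 / q ^ 2) (1 - 1 / q ^ 2) (-(1 / q)) (-((1 - q) ^ 2 * (1 + q) / q ^ 4))
      (colOp (limitData q) q x 1) (colOp (limitData q) q x 0) (colOp (gammaData q y) q x) where
  zero := limit_one_mul_zero hq₀ hq₁ hx hy
  one := limit_one_mul_one hq₀ hq₁ hx hy
  two := limit_one_mul_two hq₀ hq₁ hx hy
  grade_zero := by simpa using limit_zero_mul q (gammaData q y) x 0
  grade_one := by simpa using limit_zero_mul q (gammaData q y) x 1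
  grade_two := by simpa using limit_zero_mul q (gammaData q y) x 2

theorem colOp_gammaData_one_eq_zero (z : ℂ) (x : Fin N → ℂ) {k : Fin 3} (hk : k ≠ 0) :
    colOp (gammaData 1 z) 1 x k = 0 := by
  have h₁ : ∀ s x, (gammaData 1 z).single s x = 0 := fun s x => by
    fin_cases s <;> simp [gammaData]
  have h₂ : ∀ x, (gammaData 1 z).double x = 0 := fun x => by simp [gammaData]
  have h₃ : ∀ s t x y, (gammaData 1 z).pair s t x y = 0 := fun s t x y => by
    fin_cases s <;> fin_cases t <;> simp [gammaData, pairWeight]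
  ext a c
  match k, hk with
  | 1, _ => simp [colOp, h₁]
  | 2, _ => simp [colOp, h₂, h₃]

theorem exchange_zero_zero {q y z : ℂ} (x : Fin N → ℂ) :
    colOp (gammaData q z) q x 0 * colOp (gammaData q y) q x 0 =
      ∑ i, ∑ j, W q y z i j 0 0 •
        (colOp (gammaData q y) q x j * colOp (gammaData q z) q x i) := by
  rw [colOp_zero_mul_colOp_zero]
  simp [Fin.sum_univ_three, W]

/-- Only Γ_0 survives at q = 1, so the right side reduces to the term (0,0), whose weight vanishes
by conservation unless `k = l = 0`. -/
theorem exchange_of_eq_one {y z : ℂ} (x : Fin N → ℂ) (k l : Fin 3) :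
    colOp (gammaData 1 z) 1 x k * colOp (gammaData 1 y) 1 x l =
      ∑ i, ∑ j, W 1 y z i j k l •
        (colOp (gammaData 1 y) 1 x j * colOp (gammaData 1 z) 1 x i) := by
  by_cases h : k = 0 ∧ l = 0
  · obtain ⟨rfl, rfl⟩ := h
    exact exchange_zero_zero x
  · have hw : W 1 y z 0 0 k l = 0 := W_eq_zero _ _ _ (by
      rw [not_and_or] at h
      simp only [ne_eq, Fin.ext_iff, Fin.val_zero] at h ⊢
      omega)
    have hl : colOp (gammaData 1 z) 1 x k * colOp (gammaData 1 y) 1 x l = 0 := by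
      rw [not_and_or] at h
      rcases h with h | h <;> simp [colOp_gammaData_one_eq_zero _ x h]
    rw [hl]
    simp [Fin.sum_univ_three, hw, colOp_gammaData_one_eq_zero]

theorem exchange {q y z : ℂ} (hq₀ : q ≠ 0) (hq₁ : q ≠ -1) (hyz : Regular q z y) {x : Fin N → ℂ}
    (hx : Generic q x) (hz : ∀ i, Regular q z (x i)) (hy : ∀ i, Regular q y (x i)) (k l : Fin 3) :
    colOp (gammaData q z) q x k * colOp (gammaData q y) q x l =
      ∑ i, ∑ j, W q y z i j k l •
        (colOp (gammaData q y) q x j * colOp (gammaData q z) q x i) := by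
  -- The constants `c₀` and `c₂` to be divided by contain the factor `1 - q`.
  by_cases hq : q = 1
  · subst hq
    exact exchange_of_eq_one x k l
  have hA := isRaising_gammaData hq₀ hq₁ hx hz
  have hB := isRaising_gammaData hq₀ hq₁ hx hy
  have hK := isUnit_limit_zero hq₀ x
  have d₁ : 1 - q ≠ 0 := fun h => hq (by linear_combination -h)
  have d₂ : 1 + q ≠ 0 := fun h => hq₁ (by linear_combination h)
  have hs : 1 / q ^ 2 ≠ 0 := div_ne_zero one_ne_zero (pow_ne_zero 2 hq₀)
  have hc₀ : 1 - 1 / q ^ 2 ≠ 0 := by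
    have : 1 - 1 / q ^ 2 = -((1 - q) * (1 + q) / q ^ 2) := by field_simp; ring
    rw [this]
    exact neg_ne_zero.2 (div_ne_zero (mul_ne_zero d₁ d₂) (pow_ne_zero 2 hq₀))
  have hc₁ : -(1 / q) * -(1 / q) = 1 / q ^ 2 := by field_simp
  have hc₂ : -((1 - q) ^ 2 * (1 + q) / q ^ 4) ≠ 0 :=
    neg_ne_zero.2 (div_ne_zero (mul_ne_zero (pow_ne_zero 2 d₁) d₂) (pow_ne_zero 4 hq₀))
  have e₁₀ := exchange_of_add_eq_one hq₀ hq₁ hyz hx hz hy (k := 1) (l := 0) (by decide)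
  have e₀₁ := exchange_of_add_eq_one hq₀ hq₁ hyz hx hz hy (k := 0) (l := 1) (by decide)
  have e₀₂ := exchange_zero_two hq₀ hq₁ hyz hx hz hy
  obtain ⟨w₁, w₂⟩ := id hyz
  rw [sum_W_of_add_eq_one q y z rfl] at e₁₀ e₀₁
  rw [sum_W_of_add_eq_two q y z rfl] at e₀₂
  -- The order matters: (1,1) feeds (2,0), which feeds (2,1), which feeds (2,2), while (1,2) comes
  -- from (0,2). The side goals are identities between the weights `W`.
  have e₁₁ := hA.exchange_one_one hB hK hs hc₀ (v₂₀ := W q y z 2 0 1 1) (v₁₁ := W q y z 1 1 1 1)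
    (v₀₂ := W q y z 0 2 1 1) e₀₁ e₀₂ (by simp only [W]; field_simp; ring)
    (by simp only [W]; field_simp; ring) (by simp only [W]; field_simp; ring)
  have e₂₀ := hA.exchange_two_zero hB hK hc₂ (v₂₀ := W q y z 2 0 2 0) (v₁₁ := W q y z 1 1 2 0)
    (v₀₂ := W q y z 0 2 2 0) e₁₀ e₁₁ (by simp only [W]; field_simp; ring)
    (by simp only [W]; field_simp; ring) (by simp only [W]; field_simp; ring)
  have e₂₁ := hA.exchange_two_one hB hK hs hc₀ hc₁ (v₂₁ := W q y z 2 1 2 1)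
    (v₁₂ := W q y z 1 2 2 1) e₂₀ (by simp only [W]; field_simp; ring)
    (by simp only [W]; field_simp; ring)
  have e₁₂ := hA.exchange_one_two hB hK hs hc₀ hc₁ (v₂₁ := W q y z 2 1 1 2)
    (v₁₂ := W q y z 1 2 1 2) e₀₂ (by simp only [W]; field_simp; ring)
    (by simp only [W]; field_simp; ring)
  have e₂₂ := hA.exchange_two_two hB hK hs hc₂ e₂₁ (by simp only [W]; field_simp; ring)
  have hkl : ∀ k l : Fin 3, (k = 0 ∧ l = 0) ∨ ((k = 1 ∧ l = 0) ∨ (k = 0 ∧ l = 1)) ∨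
      (k = 1 ∧ l = 1) ∨ (k = 2 ∧ l = 0) ∨ (k = 0 ∧ l = 2) ∨ (k = 2 ∧ l = 1) ∨
      (k = 1 ∧ l = 2) ∨ (k = 2 ∧ l = 2) := by decide
  rcases hkl k l with ⟨rfl, rfl⟩ | h | ⟨rfl, rfl⟩ | ⟨rfl, rfl⟩ | ⟨rfl, rfl⟩ | ⟨rfl, rfl⟩ |
    ⟨rfl, rfl⟩ | ⟨rfl, rfl⟩
  · exact exchange_zero_zero x
  · exact exchange_of_add_eq_one hq₀ hq₁ hyz hx hz hy h
  · rw [sum_W_of_add_eq_two q y z rfl, e₁₁]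
  · rw [sum_W_of_add_eq_two q y z rfl, e₂₀]
  · exact exchange_zero_two hq₀ hq₁ hyz hx hz hy
  · rw [sum_W_of_add_eq_three q y z rfl, e₂₁]
  · rw [sum_W_of_add_eq_three q y z rfl, e₁₂]
  · rw [sum_W_two_two, e₂₂]

end IzerginKorepin

theorem mainTheorem4 (N : ℕ) (q : ℂ) (hq₀ : q ≠ 0) (hq₁ : q ≠ -1) (x : Fin N → ℂ)
    (hx : ∀ i j, i ≠ j → x i ≠ x j ∧ x i ≠ q * x j) :
    (∀ (k : Fin 3) (z : ℂ), (∀ i, x i ≠ q ^ 2 * z ∧ x i ≠ q ^ 3 * z) →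
      ∀ (σ : Equiv.Perm (Fin N)) (a b : Fin N → Fin 3),
        IzerginKorepin.Gamma q (x ∘ σ) k z (a ∘ σ) (b ∘ σ) =
          IzerginKorepin.Gamma q x k z a b) ∧
    (∀ (k l : Fin 3) (z y : ℂ),
      (∀ i, x i ≠ q ^ 2 * z ∧ x i ≠ q ^ 3 * z) →
      (∀ i, x i ≠ q ^ 2 * y ∧ x i ≠ q ^ 3 * y) →
      y ≠ q ^ 2 * z → y ≠ q ^ 3 * z →
        IzerginKorepin.Gamma q x k z * IzerginKorepin.Gamma q x l y =
          ∑ i : Fin 3, ∑ j : Fin 3,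
            IzerginKorepin.W q y z i j k l •
              (IzerginKorepin.Gamma q x j y * IzerginKorepin.Gamma q x i z)) := by
  refine ⟨fun k z _ σ a b => IzerginKorepin.Gamma_comp_perm hq₀ hq₁ x k z σ a b,
    fun k l z y hz hy hyz hyz' => ?_⟩
  simp only [IzerginKorepin.Gamma_eq_colOp hq₀ hq₁]
  exact IzerginKorepin.exchange hq₀ hq₁ ⟨sub_ne_zero.2 hyz, sub_ne_zero.2 hyz'⟩ hx
    (fun i => ⟨sub_ne_zero.2 (hz i).1, sub_ne_zero.2 (hz i).2⟩)
    (fun i => ⟨sub_ne_zero.2 (hy i).1, sub_ne_zero.2 (hy i).2⟩) k l
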